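/- Let $K$ be a (strict) 2-category. Call a 1-arrow $f\colon x\to y$ \emph{ff} if for all $g,h\colon z\to x$ every 2-arrow $f g\Rightarrow f h$ is the whiskering with $f$ of a unique 2-arrow $g\Rightarrow h$. Let $\mathsf{J}$ be a class of ff 1-arrows of $K$ which contains all identities and is closed under composition, such that for every $j\in\mathsf{J}$ a strict pullback of $j$ along any 1-arrow (in the underlying 1-category of $K$) is specified, its projection opposite to $j$ being again in $\mathsf{J}$, and such that every $j\colon u\to x$ in $\mathsf{J}$ is strictly 2-regular: for all $f,g\colon x\to y$, every 2-arrow $f j\Rightarrow g j$ whose whiskerings with the two projections $u\times_x u\rightrightarrows u$ agree is the whiskering with $j$ of a unique 2-arrow $f\Rightarrow g$. Let $K_\mathsf{J}$ be the bicategory of $\mathsf{J}$-fractions. It has the objects of $K$. Its 1-arrows $x\to y$ are the spans $(j,f)=(x\xleftarrow{j}u\xrightarrow{f}y)$ with $j\in\mathsf{J}$, composed by pullback, with identities $(\mathrm{id}_x,\mathrm{id}_x)$. Its 2-arrows $(j,f)\Rightarrow(k,g)$, where $j\colon u\to x$ and $k\colon v\to x$, are the 2-arrows $f\circ\mathrm{pr}_1\Rightarrow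 g\circ\mathrm{pr}_2$ of $K$ on $u\times_x v$; the vertical composite of $t_1\colon(j_1,f_1)\Rightarrow(j_2,f_2)$ and $t_2\colon(j_2,f_2)\Rightarrow(j_3,f_3)$ is the unique descent along $u_1\times_x u_2\times_x u_3\to u_1\times_x u_3$ of the composite of the restrictions of $t_1$ and $t_2$, and the identity of $(j,f)$ is $f$ applied to the unique 2-arrow $\mathrm{pr}_1\Rightarrow\mathrm{pr}_2\colon u\times_x u\to u$ lifting the identity through $j$. (The whiskerings and coherence 2-arrows are the canonical ones, obtained by lifting through and descending along arrows of $\mathsf{J}$.) For a 1-arrow $f\colon x\to y$ of $K$ let $A_\mathsf{J}(f)$ be the fraction $(\mathrm{id}_x,f)\colon x\to y$. A 1-arrow $q\colon x\to y$ of $K$ is \emph{$\mathsf{J}$-locally split} if there are $j\colon u\to y$ in $\mathsf{J}$, a 1-arrow $s\colon u\to x$ and an invertible 2-arrow $q s\cong j$; it is a \emph{weak equivalence} if it is ff and $\mathsf{J}$-locally split. Then, for every 1-arrow $f$ of $K$, the 1-arrow $A_\mathsf{J}(f)$ is an equivalence in the bicategory $K_\mathsf{J}$ if and only if $f$ is a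 weak equivalence. -/

import Mathlib

open CategoryTheory Bicategory

universe w v u

namespace JFractions

set_option linter.unusedSimpArgs false

/-- A 1-arrow `f : x ⟶ y` of a bicategory is *ff* (representably fully faithful) if every
2-arrow `g ≫ f ⟶ h ≫ f` is the whiskering with `f` of a unique 2-arrow `g ⟶ h`. -/
def IsFF {K : Type u} [Bicategory.{w, v} K] {x y : K} (f : x ⟶ y) : Prop :=
  ∀ ⦃z : K⦄ (g h : z ⟶ x) (a : g ≫ f ⟶ h ≫ f), ∃! b : g ⟶ h, b ▷ f = a

/-- `p : u ⟶ x` is *strictly 2-regular* with respect to its strict kernel pair `q₁, q₂ : k ⟶ u`: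
for all `f, g : x ⟶ y`, every 2-arrow `a : p ≫ f ⟶ p ≫ g` whose whiskerings with `q₁` and `q₂`
agree (up to the equalities `qᵢ ≫ p ≫ f = (qᵢ ≫ p) ≫ f` and `q₁ ≫ p = q₂ ≫ p`)
descends uniquely along `p`. -/
def IsStrictlyTwoRegular {K : Type u} [Bicategory.{w, v} K] [Bicategory.Strict K] {u x k : K}
    (p : u ⟶ x) (q₁ q₂ : k ⟶ u) (comm : q₁ ≫ p = q₂ ≫ p) : Prop :=
  ∀ ⦃y : K⦄ (f g : x ⟶ y) (a : p ≫ f ⟶ p ≫ g),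
    q₁ ◁ a = eqToHom (by rw [← Strict.assoc, comm, Strict.assoc]) ≫ q₂ ◁ a ≫
      eqToHom (by rw [← Strict.assoc, ← comm, Strict.assoc]) →
    ∃! b : f ⟶ g, p ◁ b = a

/-- A strict subcanonical unary 2-site structure on the 2-category `K` whose covers are ff: a class
`J` of ff 1-arrows containing identities, closed under composition, with specified strict pullbacks
along arbitrary 1-arrows which are again in `J`, all of whose members are strictly 2-regular. -/
structure TwoSite (K : Type u) [Bicategory.{w, v} K] [Bicategory.Strict K] where
  /-- the covers -/
  J : ∀ ⦃x y : K⦄, (x ⟶ y) → Prop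
  id_mem : ∀ x : K, J (𝟙 x)
  comp_mem : ∀ ⦃x y z : K⦄ {f : x ⟶ y} {g : y ⟶ z}, J f → J g → J (f ≫ g)
  /-- the specified strict pullback of the cover `j` along `f` -/
  pb : ∀ ⦃a x u : K⦄ (_ : a ⟶ x) (j : u ⟶ x), J j → K
  /-- its projection to the source of `f` -/
  fst : ∀ ⦃a x u : K⦄ (f : a ⟶ x) (j : u ⟶ x) (hj : J j), pb f j hj ⟶ a
  /-- its projection to the source of `j` -/
  snd : ∀ ⦃a x u : K⦄ (f : a ⟶ x) (j : u ⟶ x) (hj : J j), pb f j hj ⟶ u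
  /-- it is a pullback in the underlying 1-category of `K` -/
  isPullback : ∀ ⦃a x u : K⦄ (f : a ⟶ x) (j : u ⟶ x) (hj : J j),
    IsPullback (fst f j hj) (snd f j hj) f j
  fst_mem : ∀ ⦃a x u : K⦄ (f : a ⟶ x) (j : u ⟶ x) (hj : J j), J (fst f j hj)
  ff : ∀ ⦃u x : K⦄ (j : u ⟶ x), J j → IsFF j
  /-- subcanonicity -/
  regular : ∀ ⦃u x : K⦄ (j : u ⟶ x) (hj : J j),
    IsStrictlyTwoRegular j (fst j j hj) (snd j j hj) (isPullback j j hj).w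

variable {K : Type u} [Bicategory.{w, v} K] [Bicategory.Strict K]

section ff

/-- The unique lift of a 2-arrow through an ff 1-arrow. -/
noncomputable def IsFF.lift {x y : K} {f : x ⟶ y} (hf : IsFF f) {z : K} {g h : z ⟶ x}
    (a : g ≫ f ⟶ h ≫ f) : g ⟶ h :=
  (hf g h a).choose

@[simp]
lemma IsFF.lift_whiskerRight {x y : K} {f : x ⟶ y} (hf : IsFF f) {z : K} {g h : z ⟶ x}
    (a : g ≫ f ⟶ h ≫ f) : hf.lift a ▷ f = a :=
  (hf g h a).choose_spec.1

lemma IsFF.hom_ext {x y : K} {f : x ⟶ y} (hf : IsFF f) {z : K} {g h : z ⟶ x}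
    {a b : g ⟶ h} (e : a ▷ f = b ▷ f) : a = b :=
  (hf g h (b ▷ f)).unique e rfl

lemma IsFF.lift_comp {x y : K} {f : x ⟶ y} (hf : IsFF f) {z : K} {g h k : z ⟶ x}
    (a : g ≫ f ⟶ h ≫ f) (b : h ≫ f ⟶ k ≫ f) : hf.lift (a ≫ b) = hf.lift a ≫ hf.lift b :=
  hf.hom_ext (by simp)

@[simp]
lemma IsFF.lift_id {x y : K} {f : x ⟶ y} (hf : IsFF f) {z : K} (g : z ⟶ x) :
    hf.lift (𝟙 (g ≫ f)) = 𝟙 g :=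
  hf.hom_ext (by simp)

end ff

namespace TwoSite

variable (S : TwoSite K)

lemma exists_descent {x u : K} {j : u ⟶ x} (hj : S.J j) {y : K} {f g : x ⟶ y}
    (a : j ≫ f ⟶ j ≫ g) : ∃! b : f ⟶ g, j ◁ b = a := by
  apply S.regular j hj
  have comm : S.fst j j hj ≫ j = S.snd j j hj ≫ j := (S.isPullback j j hj).w
  have ex := whisker_exchange ((S.ff j hj).lift (eqToHom comm)) a
  have e (f : x ⟶ y) : (S.ff j hj).lift (eqToHom comm) ▷ (j ≫ f) =
      eqToHom (by rw [← Strict.assoc, comm, Strict.assoc]) := by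
    rw [whiskerRight_comp]
    simp [Strict.associator_eqToIso]
  rw [e, e] at ex
  rw [← cancel_mono (eqToHom (by rw [← Strict.assoc, comm, Strict.assoc] :
    S.fst j j hj ≫ j ≫ g = S.snd j j hj ≫ j ≫ g)), ex]
  simp

/-- The unique descent of a 2-arrow along a cover. -/
noncomputable def desc {x u : K} {j : u ⟶ x} (hj : S.J j) {y : K} {f g : x ⟶ y}
    (a : j ≫ f ⟶ j ≫ g) : f ⟶ g :=
  (S.exists_descent hj a).choose

@[simp]
lemma whiskerLeft_desc {x u : K} {j : u ⟶ x} (hj : S.J j) {y : K} {f g : x ⟶ y}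
    (a : j ≫ f ⟶ j ≫ g) : j ◁ S.desc hj a = a :=
  (S.exists_descent hj a).choose_spec.1

lemma hom_ext_of_cover {x u : K} {j : u ⟶ x} (hj : S.J j) {y : K} {f g : x ⟶ y}
    {a b : f ⟶ g} (e : j ◁ a = j ◁ b) : a = b :=
  (S.exists_descent hj (j ◁ b)).unique e rfl

end TwoSite

/-- A fraction from `x` to `y`: a span `x ⟵ apex ⟶ y` whose left leg is a cover. -/
structure Fraction (S : TwoSite K) (x y : K) where
  apex : K
  cover : apex ⟶ x
  mem : S.J cover
  arrow : apex ⟶ y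

namespace Fraction

variable {S : TwoSite K} {x y z : K}

/-- The fraction `(𝟙, f)`. -/
abbrev ofArrow (S : TwoSite K) (f : x ⟶ y) : Fraction S x y where
  apex := x
  cover := 𝟙 x
  mem := S.id_mem x
  arrow := f

/-- Composition of fractions: the composite span, formed with the specified pullback. -/
abbrev comp (F : Fraction S x y) (G : Fraction S y z) : Fraction S x z where
  apex := S.pb F.arrow G.cover G.mem
  cover := S.fst F.arrow G.cover G.mem ≫ F.cover
  mem := S.comp_mem (S.fst_mem _ _ _) F.mem
  arrow := S.snd F.arrow G.cover G.mem ≫ G.arrow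

/-- The specified pullback `F.apex ×_x G.apex`. -/
abbrev prod (F G : Fraction S x y) : K := S.pb F.cover G.cover G.mem

/-- The projection to the apex of the first factor. -/
abbrev pr₁ (F G : Fraction S x y) : F.prod G ⟶ F.apex := S.fst F.cover G.cover G.mem

/-- The projection to the apex of the second factor. -/
abbrev pr₂ (F G : Fraction S x y) : F.prod G ⟶ G.apex := S.snd F.cover G.cover G.mem

lemma pr_comm (F G : Fraction S x y) : F.pr₁ G ≫ F.cover = F.pr₂ G ≫ G.cover :=
  (S.isPullback F.cover G.cover G.mem).w

end Fraction

/-- A map of fractions `(j, f) ⟶ (k, g)`: a 2-arrow `f ∘ pr₁ ⟶ g ∘ pr₂` on `u ×_x v`. -/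
@[ext]
structure FractionMap {S : TwoSite K} {x y : K} (F G : Fraction S x y) where
  cell : F.pr₁ G ≫ F.arrow ⟶ F.pr₂ G ≫ G.arrow

namespace FractionMap

variable {S : TwoSite K} {x y z : K}

/-- The restriction of a map of fractions along the 1-arrow `⟨p, q⟩ : a ⟶ F.apex ×_x G.apex`. -/
noncomputable def atCone {F G : Fraction S x y} (t : FractionMap F G) {a : K} (p : a ⟶ F.apex)
    (q : a ⟶ G.apex) (h : p ≫ F.cover = q ≫ G.cover) : p ≫ F.arrow ⟶ q ≫ G.arrow :=
  let l : a ⟶ F.prod G := (S.isPullback F.cover G.cover G.mem).lift p q h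
  have h₁ : l ≫ F.pr₁ G = p := (S.isPullback F.cover G.cover G.mem).lift_fst p q h
  have h₂ : l ≫ F.pr₂ G = q := (S.isPullback F.cover G.cover G.mem).lift_snd p q h
  eqToHom (by rw [← Strict.assoc, h₁]) ≫ l ◁ t.cell ≫ eqToHom (by rw [← Strict.assoc, h₂])

/-- The identity map of a fraction: the canonical 2-arrow `pr₁ ⟶ pr₂` on `u ×_x u` lifting the
identity through the cover, whiskered with the right leg. -/
noncomputable def id (F : Fraction S x y) : FractionMap F F where
  cell := (S.ff F.cover F.mem).lift (eqToHom (F.pr_comm F)) ▷ F.arrow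

/-- Vertical composition: the 2-arrow on the triple pullback `(u₁ ×_x u₃) ×_x u₂` obtained by
composing the restrictions of `s` and `t`, descended along the projection to `u₁ ×_x u₃`. -/
noncomputable def comp {F G H : Fraction S x y} (s : FractionMap F G) (t : FractionMap G H) :
    FractionMap F H where
  cell :=
    let p₁₃ := S.fst (F.pr₁ H ≫ F.cover) G.cover G.mem
    let p₂ := S.snd (F.pr₁ H ≫ F.cover) G.cover G.mem
    have h₁ : p₁₃ ≫ F.pr₁ H ≫ F.cover = p₂ ≫ G.cover := (S.isPullback _ _ _).w
    have h₂ : p₁₃ ≫ F.pr₂ H ≫ H.cover = p₂ ≫ G.cover := by rw [← F.pr_comm H, h₁]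
    S.desc (S.fst_mem (F.pr₁ H ≫ F.cover) G.cover G.mem)
      ((α_ p₁₃ (F.pr₁ H) F.arrow).inv ≫
        s.atCone (p₁₃ ≫ F.pr₁ H) p₂ (by rw [Strict.assoc, h₁]) ≫
        t.atCone p₂ (p₁₃ ≫ F.pr₂ H) (by rw [Strict.assoc, h₂]) ≫
        (α_ p₁₃ (F.pr₂ H) H.arrow).hom)


lemma atCone_pr {F G : Fraction S x y} (t : FractionMap F G) :
    t.atCone (F.pr₁ G) (F.pr₂ G) (F.pr_comm G) = t.cell := by
  have key : ∀ (l : F.prod G ⟶ F.prod G) (hl : l = 𝟙 _)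
      (h₁ : F.pr₁ G ≫ F.arrow = l ≫ F.pr₁ G ≫ F.arrow)
      (h₂ : l ≫ F.pr₂ G ≫ G.arrow = F.pr₂ G ≫ G.arrow),
      eqToHom h₁ ≫ l ◁ t.cell ≫ eqToHom h₂ = t.cell := by
    rintro l rfl h₁ h₂
    simp [Strict.leftUnitor_eqToIso]
  apply key
  apply (S.isPullback F.cover G.cover G.mem).hom_ext
  · rw [IsPullback.lift_fst]; exact (Strict.id_comp _).symm
  · rw [IsPullback.lift_snd]; exact (Strict.id_comp _).symm

lemma atCone_lift {F G : Fraction S x y} (t : FractionMap F G) {a : K} (l : a ⟶ F.prod G)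
    (h : (l ≫ F.pr₁ G) ≫ F.cover = (l ≫ F.pr₂ G) ≫ G.cover) :
    t.atCone (l ≫ F.pr₁ G) (l ≫ F.pr₂ G) h =
      (α_ l (F.pr₁ G) F.arrow).hom ≫ l ◁ t.cell ≫ (α_ l (F.pr₂ G) G.arrow).inv := by
  have key : ∀ (l' : a ⟶ F.prod G) (hl : l' = l)
      (h₁ : (l ≫ F.pr₁ G) ≫ F.arrow = l' ≫ F.pr₁ G ≫ F.arrow)
      (h₂ : l' ≫ F.pr₂ G ≫ G.arrow = (l ≫ F.pr₂ G) ≫ G.arrow),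
      eqToHom h₁ ≫ l' ◁ t.cell ≫ eqToHom h₂ =
        (α_ l (F.pr₁ G) F.arrow).hom ≫ l ◁ t.cell ≫ (α_ l (F.pr₂ G) G.arrow).inv := by
    rintro l' rfl h₁ h₂
    simp [Strict.associator_eqToIso]
  apply key
  apply (S.isPullback F.cover G.cover G.mem).hom_ext
  · rw [IsPullback.lift_fst]
  · rw [IsPullback.lift_snd]

lemma exists_cone {F G : Fraction S x y} {a : K} (p : a ⟶ F.apex)
    (q : a ⟶ G.apex) (h : p ≫ F.cover = q ≫ G.cover) :
    ∃ l : a ⟶ F.prod G, l ≫ F.pr₁ G = p ∧ l ≫ F.pr₂ G = q :=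
  ⟨(S.isPullback F.cover G.cover G.mem).lift p q h, IsPullback.lift_fst _ _ _ _,
    IsPullback.lift_snd _ _ _ _⟩

lemma atCone_comp {F G : Fraction S x y} (t : FractionMap F G) {a b : K} (r : b ⟶ a)
    (p : a ⟶ F.apex) (q : a ⟶ G.apex) (h : p ≫ F.cover = q ≫ G.cover)
    (h' : (r ≫ p) ≫ F.cover = (r ≫ q) ≫ G.cover) :
    t.atCone (r ≫ p) (r ≫ q) h' =
      (α_ r p F.arrow).hom ≫ r ◁ t.atCone p q h ≫ (α_ r q G.arrow).inv := by
  obtain ⟨l, rfl, rfl⟩ := exists_cone p q h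
  have key : ∀ (p' : b ⟶ F.apex) (q' : b ⟶ G.apex) (hp : p' = (r ≫ l) ≫ F.pr₁ G)
      (hq : q' = (r ≫ l) ≫ F.pr₂ G) (h'), t.atCone p' q' h' =
      eqToHom (by rw [hp]) ≫ t.atCone ((r ≫ l) ≫ F.pr₁ G) ((r ≫ l) ≫ F.pr₂ G)
        (by rw [← hp, ← hq, h']) ≫ eqToHom (by rw [hq]) := by
    rintro _ _ rfl rfl h'
    simp
  rw [key _ _ (Strict.assoc _ _ _).symm (Strict.assoc _ _ _).symm, atCone_lift, atCone_lift]
  simp [Strict.associator_eqToIso]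

/-- Restrictions along strict cones, up to equality of 1-arrows. -/
lemma atCone_congr {F G : Fraction S x y} (t : FractionMap F G) {a : K}
    {p p' : a ⟶ F.apex} {q q' : a ⟶ G.apex} (hp : p = p') (hq : q = q')
    (h : p ≫ F.cover = q ≫ G.cover) :
    t.atCone p q h = eqToHom (by rw [hp]) ≫ t.atCone p' q' (by rw [← hp, ← hq, h]) ≫
      eqToHom (by rw [hq]) := by
  subst hp hq
  simp

/-- The extension of a map of fractions `t` to cones commuting up to a 2-arrow `θ`. -/
noncomputable def app {F G : Fraction S x y} (t : FractionMap F G) {a : K} (p : a ⟶ F.apex)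
    (q : a ⟶ G.apex) (θ : p ≫ F.cover ⟶ q ≫ G.cover) : p ≫ F.arrow ⟶ q ≫ G.arrow :=
  let π := S.fst (q ≫ G.cover) F.cover F.mem
  let r := S.snd (q ≫ G.cover) F.cover F.mem
  have h : π ≫ q ≫ G.cover = r ≫ F.cover := (S.isPullback _ _ _).w
  S.desc (S.fst_mem (q ≫ G.cover) F.cover F.mem)
    ((α_ π p F.arrow).inv ≫
      (S.ff F.cover F.mem).lift ((α_ π p F.cover).hom ≫ π ◁ θ ≫ eqToHom h) ▷ F.arrow ≫
      t.atCone r (π ≫ q) (by rw [Strict.assoc, h]) ≫ (α_ π q G.arrow).hom)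

lemma whiskerLeft_app {F G : Fraction S x y} (t : FractionMap F G) {a b : K} (p : a ⟶ F.apex)
    (q : a ⟶ G.apex) (θ : p ≫ F.cover ⟶ q ≫ G.cover) (s : b ⟶ a) (r : b ⟶ F.apex)
    (h : s ≫ q ≫ G.cover = r ≫ F.cover) :
    s ◁ t.app p q θ =
      (α_ s p F.arrow).inv ≫
      (S.ff F.cover F.mem).lift ((α_ s p F.cover).hom ≫ s ◁ θ ≫ eqToHom h) ▷ F.arrow ≫
      t.atCone r (s ≫ q) (by rw [Strict.assoc, h]) ≫ (α_ s q G.arrow).hom := by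
  obtain ⟨l, rfl, rfl⟩ : ∃ l : b ⟶ S.pb (q ≫ G.cover) F.cover F.mem,
      l ≫ S.fst (q ≫ G.cover) F.cover F.mem = s ∧ l ≫ S.snd (q ≫ G.cover) F.cover F.mem = r :=
    ⟨(S.isPullback _ _ _).lift s r h, IsPullback.lift_fst _ _ _ _, IsPullback.lift_snd _ _ _ _⟩
  have hw : S.fst (q ≫ G.cover) F.cover F.mem ≫ q ≫ G.cover =
    S.snd (q ≫ G.cover) F.cover F.mem ≫ F.cover := (S.isPullback _ _ _).w
  rw [comp_whiskerLeft, app, S.whiskerLeft_desc]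
  rw [atCone_congr t rfl (Strict.assoc l (S.fst (q ≫ G.cover) F.cover F.mem) q),
    atCone_comp t l _ _ (by rw [Strict.assoc, hw])]
  have hl : (S.ff F.cover F.mem).lift
      ((α_ (l ≫ S.fst (q ≫ G.cover) F.cover F.mem) p F.cover).hom ≫
        (l ≫ S.fst (q ≫ G.cover) F.cover F.mem) ◁ θ ≫ eqToHom h) =
      (α_ _ _ _).hom ≫ l ◁ (S.ff F.cover F.mem).lift
        ((α_ (S.fst (q ≫ G.cover) F.cover F.mem) p F.cover).hom ≫
          S.fst (q ≫ G.cover) F.cover F.mem ◁ θ ≫ eqToHom hw) := by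
    apply (S.ff F.cover F.mem).hom_ext
    simp [Strict.associator_eqToIso]
  rw [hl]
  simp [Strict.associator_eqToIso]


lemma exists_cover (F : Fraction S x y) {a : K} (k : a ⟶ x) :
    ∃ (b : K) (π : b ⟶ a) (r : b ⟶ F.apex), S.J π ∧ π ≫ k = r ≫ F.cover :=
  ⟨_, _, _, S.fst_mem k F.cover F.mem, (S.isPullback k F.cover F.mem).w⟩

lemma atCone_naturality {F G : Fraction S x y} (t : FractionMap F G) {a : K}
    {p p' : a ⟶ F.apex} {q q' : a ⟶ G.apex} (σ : p ⟶ p') (τ : q ⟶ q')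
    (h : p ≫ F.cover = q ≫ G.cover) (h' : p' ≫ F.cover = q' ≫ G.cover)
    (hc : σ ▷ F.cover ≫ eqToHom h' = eqToHom h ≫ τ ▷ G.cover) :
    t.atCone p q h ≫ τ ▷ G.arrow = σ ▷ F.arrow ≫ t.atCone p' q' h' := by
  obtain ⟨l, rfl, rfl⟩ := exists_cone p q h
  obtain ⟨l', rfl, rfl⟩ := exists_cone p' q' h'
  obtain ⟨ν, rfl, -⟩ := S.ff _ (S.fst_mem F.cover G.cover G.mem) l l' σ
  have hτ : τ = ν ▷ F.pr₂ G := by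
    apply (S.ff _ G.mem).hom_ext
    have e : ∀ (m : F.prod G ⟶ x) (hm : F.pr₁ G ≫ F.cover = m), (ν ▷ F.pr₁ G) ▷ F.cover =
      (α_ _ _ _).hom ≫ eqToHom (by rw [hm]) ≫ ν ▷ m ≫ eqToHom (by rw [hm]) ≫ (α_ _ _ _).inv := by
      rintro _ rfl
      simp
    rw [e _ (F.pr_comm G)] at hc
    rw [← cancel_epi (eqToHom h), ← hc]
    simp [Strict.associator_eqToIso]
  subst hτ
  rw [atCone_lift, atCone_lift]
  have := whisker_exchange ν t.cell
  rw [whiskerRight_comp, whiskerRight_comp] at this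
  simp only [Category.assoc] at this ⊢
  rw [← cancel_mono (α_ l' (F.pr₂ G) G.arrow).hom, ← cancel_epi (α_ l (F.pr₁ G) F.arrow).inv]
  simpa using this

lemma app_nat_left {F G : Fraction S x y} (t : FractionMap F G) {a : K} {p p' : a ⟶ F.apex}
    {q : a ⟶ G.apex} (σ : p' ⟶ p) (θ : p ≫ F.cover ⟶ q ≫ G.cover) :
    t.app p' q (σ ▷ F.cover ≫ θ) = σ ▷ F.arrow ≫ t.app p q θ := by
  apply S.hom_ext_of_cover (S.fst_mem (q ≫ G.cover) F.cover F.mem)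
  have hw := (S.isPullback (q ≫ G.cover) F.cover F.mem).w
  rw [whiskerLeft_comp, whiskerLeft_app t _ _ _ _ _ hw, whiskerLeft_app t _ _ _ _ _ hw]
  have hl : (S.ff F.cover F.mem).lift ((α_ (S.fst (q ≫ G.cover) F.cover F.mem) p' F.cover).hom ≫
        S.fst (q ≫ G.cover) F.cover F.mem ◁ (σ ▷ F.cover ≫ θ) ≫ eqToHom hw) =
      S.fst (q ≫ G.cover) F.cover F.mem ◁ σ ≫ (S.ff F.cover F.mem).lift
        ((α_ (S.fst (q ≫ G.cover) F.cover F.mem) p F.cover).hom ≫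
          S.fst (q ≫ G.cover) F.cover F.mem ◁ θ ≫ eqToHom hw) := by
    apply (S.ff F.cover F.mem).hom_ext
    simp
  rw [hl]
  simp

lemma app_nat_right {F G : Fraction S x y} (t : FractionMap F G) {a : K} {p : a ⟶ F.apex}
    {q q' : a ⟶ G.apex} (θ : p ≫ F.cover ⟶ q ≫ G.cover) (τ : q ⟶ q') :
    t.app p q' (θ ≫ τ ▷ G.cover) = t.app p q θ ≫ τ ▷ G.arrow := by
  obtain ⟨b, π, r, hπ, hw⟩ := exists_cover F (q ≫ G.cover)
  obtain ⟨c, π', r', hπ', hw'⟩ := exists_cover F ((π ≫ q') ≫ G.cover)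
  have h₁ : (π' ≫ π) ≫ q ≫ G.cover = (π' ≫ r) ≫ F.cover := by
    rw [Strict.assoc, hw, Strict.assoc]
  have h₂ : (π' ≫ π) ≫ q' ≫ G.cover = r' ≫ F.cover := by
    rw [← hw', Strict.assoc, Strict.assoc]
  apply S.hom_ext_of_cover (S.comp_mem hπ' hπ)
  rw [whiskerLeft_comp, whiskerLeft_app t _ _ _ _ _ h₁, whiskerLeft_app t _ _ _ _ _ h₂]
  have nat := t.atCone_naturality (p := π' ≫ r) (p' := r') (q := (π' ≫ π) ≫ q)
    (q' := (π' ≫ π) ≫ q')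
    ((S.ff F.cover F.mem).lift (eqToHom h₁.symm ≫ (π' ≫ π) ◁ τ ▷ G.cover ≫ eqToHom h₂))
    ((π' ≫ π) ◁ τ) (h₁.symm.trans (Strict.assoc _ _ _).symm) (h₂.symm.trans (Strict.assoc _ _ _).symm)
    (by simp [Strict.associator_eqToIso])
  have hl : (S.ff F.cover F.mem).lift ((α_ (π' ≫ π) p F.cover).hom ≫
        (π' ≫ π) ◁ (θ ≫ τ ▷ G.cover) ≫ eqToHom h₂) =
      (S.ff F.cover F.mem).lift ((α_ (π' ≫ π) p F.cover).hom ≫ (π' ≫ π) ◁ θ ≫ eqToHom h₁) ≫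
      (S.ff F.cover F.mem).lift (eqToHom h₁.symm ≫ (π' ≫ π) ◁ τ ▷ G.cover ≫ eqToHom h₂) := by
    apply (S.ff F.cover F.mem).hom_ext
    simp
  rw [hl, Bicategory.comp_whiskerRight]
  simp only [Category.assoc]
  rw [← reassoc_of% nat]
  simp only [associator_naturality_middle]

lemma app_congr {F G : Fraction S x y} (t : FractionMap F G) {a : K}
    {p p' : a ⟶ F.apex} {q q' : a ⟶ G.apex} (hp : p = p') (hq : q = q')
    (θ : p ≫ F.cover ⟶ q ≫ G.cover) :
    t.app p q θ = eqToHom (by rw [hp]) ≫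
      t.app p' q' (eqToHom (by rw [hp]) ≫ θ ≫ eqToHom (by rw [hq])) ≫ eqToHom (by rw [hq]) := by
  subst hp hq
  simp

lemma app_nat_dom {F G : Fraction S x y} (t : FractionMap F G) {a b : K} (s : b ⟶ a)
    (p : a ⟶ F.apex) (q : a ⟶ G.apex) (θ : p ≫ F.cover ⟶ q ≫ G.cover) :
    t.app (s ≫ p) (s ≫ q) ((α_ s p F.cover).hom ≫ s ◁ θ ≫ (α_ s q G.cover).inv) =
      (α_ s p F.arrow).hom ≫ s ◁ t.app p q θ ≫ (α_ s q G.arrow).inv := by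
  obtain ⟨c, π, r, hπ, hw⟩ := exists_cover F ((s ≫ q) ≫ G.cover)
  apply S.hom_ext_of_cover hπ
  have h : (π ≫ s) ≫ q ≫ G.cover = r ≫ F.cover := by rw [← hw]; simp only [Strict.assoc]
  have e := whiskerLeft_app t p q θ _ _ h
  rw [comp_whiskerLeft] at e
  rw [whiskerLeft_app t _ _ _ _ _ hw]
  rw [whiskerLeft_comp π (α_ s p F.arrow).hom, whiskerLeft_comp π (s ◁ _)]
  have e' : π ◁ s ◁ t.app p q θ = (α_ _ _ _).inv ≫ ((α_ π s (p ≫ F.arrow)).hom ≫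
    π ◁ s ◁ t.app p q θ ≫ (α_ π s (q ≫ G.arrow)).inv) ≫ (α_ _ _ _).hom := by simp
  rw [e', e, atCone_congr t rfl (Strict.assoc π s q)]
  have hl : (S.ff F.cover F.mem).lift ((α_ π (s ≫ p) F.cover).hom ≫
        π ◁ ((α_ s p F.cover).hom ≫ s ◁ θ ≫ (α_ s q G.cover).inv) ≫ eqToHom hw) =
      (α_ _ _ _).inv ≫
      (S.ff F.cover F.mem).lift ((α_ (π ≫ s) p F.cover).hom ≫ (π ≫ s) ◁ θ ≫ eqToHom h) := by
    apply (S.ff F.cover F.mem).hom_ext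
    simp [Strict.associator_eqToIso]
  rw [hl]
  simp [Strict.associator_eqToIso]

lemma app_eqToHom {F G : Fraction S x y} (t : FractionMap F G) {a : K} (p : a ⟶ F.apex)
    (q : a ⟶ G.apex) (h : p ≫ F.cover = q ≫ G.cover) :
    t.app p q (eqToHom h) = t.atCone p q h := by
  have h' : 𝟙 a ≫ q ≫ G.cover = p ≫ F.cover := by rw [Strict.id_comp, h]
  have e := whiskerLeft_app t p q (eqToHom h) _ _ h'
  have hl : (S.ff F.cover F.mem).lift ((α_ (𝟙 a) p F.cover).hom ≫
      𝟙 a ◁ eqToHom h ≫ eqToHom h') = eqToHom (Strict.id_comp _) := by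
    apply (S.ff F.cover F.mem).hom_ext
    simp [Strict.associator_eqToIso]
  rw [hl, atCone_congr t rfl (Strict.id_comp q)] at e
  rw [id_whiskerLeft] at e
  rw [← cancel_epi (λ_ (p ≫ F.arrow)).hom, ← cancel_mono (λ_ (q ≫ G.arrow)).inv,
    Category.assoc, e]
  simp [Strict.associator_eqToIso, Strict.leftUnitor_eqToIso]

end FractionMap

/-- A family of operations turning 2-arrows `p ≫ l ⟶ q ≫ l'` into 2-arrows `p ≫ r ⟶ q ≫ r'`,
natural in all variables. This is an auxiliary device: maps of fractions correspond to such
families, and families are easier to combine. -/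
structure Fam {x y m n : K} (l : m ⟶ x) (r : m ⟶ y) (l' : n ⟶ x) (r' : n ⟶ y) where
  app : ∀ {a : K} (p : a ⟶ m) (q : a ⟶ n), (p ≫ l ⟶ q ≫ l') → (p ≫ r ⟶ q ≫ r')
  nat_left : ∀ {a : K} {p p' : a ⟶ m} {q : a ⟶ n} (σ : p' ⟶ p) (θ : p ≫ l ⟶ q ≫ l'),
    app p' q (σ ▷ l ≫ θ) = σ ▷ r ≫ app p q θ
  nat_right : ∀ {a : K} {p : a ⟶ m} {q q' : a ⟶ n} (θ : p ≫ l ⟶ q ≫ l') (τ : q ⟶ q'),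
    app p q' (θ ≫ τ ▷ l') = app p q θ ≫ τ ▷ r'
  nat_dom : ∀ {a b : K} (s : b ⟶ a) (p : a ⟶ m) (q : a ⟶ n) (θ : p ≫ l ⟶ q ≫ l'),
    app (s ≫ p) (s ≫ q) ((α_ s p l).hom ≫ s ◁ θ ≫ (α_ s q l').inv) =
      (α_ s p r).hom ≫ s ◁ app p q θ ≫ (α_ s q r').inv

namespace Fam

variable {x y z : K}

/-- Precomposition of the first span with a 1-arrow. -/
@[simps]
def pullLeft {m n m' : K} {l : m ⟶ x} {r : m ⟶ y} {l' : n ⟶ x} {r' : n ⟶ y} (φ : Fam l r l' r')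
    (e : m' ⟶ m) : Fam (e ≫ l) (e ≫ r) l' r' where
  app p q θ := (α_ p e r).inv ≫ φ.app (p ≫ e) q ((α_ p e l).hom ≫ θ)
  nat_left σ θ := by
    have := φ.nat_left (σ ▷ e) ((α_ _ e l).hom ≫ θ)
    simp only [whiskerRight_comp, Category.assoc] at this ⊢
    simp [this]
  nat_right θ τ := by
    have := φ.nat_right ((α_ _ e l).hom ≫ θ) τ
    simp only [Category.assoc] at this ⊢
    simp [this]
  nat_dom s p q θ := by
    have := φ.nat_dom s (p ≫ e) q ((α_ _ e l).hom ≫ θ)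
    have h := φ.nat_left (α_ s p e).hom
      ((α_ s (p ≫ e) l).hom ≫ s ◁ ((α_ p e l).hom ≫ θ) ≫ (α_ s q l').inv)
    rw [this] at h
    have e1 : (α_ (s ≫ p) e l).hom ≫ ((α_ s p (e ≫ l)).hom ≫ s ◁ θ ≫ (α_ s q l').inv) =
        (α_ s p e).hom ▷ l ≫ (α_ s (p ≫ e) l).hom ≫
          s ◁ ((α_ p e l).hom ≫ θ) ≫ (α_ s q l').inv := by
      simp
    rw [e1, h]
    simp

/-- Precomposition of the second span with a 1-arrow. -/
@[simps]
def pullRight {m n n' : K} {l : m ⟶ x} {r : m ⟶ y} {l' : n ⟶ x} {r' : n ⟶ y} (φ : Fam l r l' r')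
    (e : n' ⟶ n) : Fam l r (e ≫ l') (e ≫ r') where
  app p q θ := φ.app p (q ≫ e) (θ ≫ (α_ q e l').inv) ≫ (α_ q e r').hom
  nat_left σ θ := by
    have := φ.nat_left σ (θ ≫ (α_ _ e l').inv)
    simp only [Category.assoc] at this ⊢
    simp [reassoc_of% this]
  nat_right θ τ := by
    have := φ.nat_right (θ ≫ (α_ _ e l').inv) (τ ▷ e)
    simp only [whiskerRight_comp, Category.assoc, Iso.hom_inv_id_assoc] at this ⊢
    simp [reassoc_of% this]
  nat_dom s p q θ := by
    have := φ.nat_dom s p (q ≫ e) (θ ≫ (α_ _ e l').inv)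
    have h := φ.nat_right
      ((α_ s p l).hom ≫ s ◁ (θ ≫ (α_ q e l').inv) ≫ (α_ s (q ≫ e) l').inv) (α_ s q e).inv
    rw [this] at h
    have e1 : ((α_ s p l).hom ≫ s ◁ θ ≫ (α_ s q (e ≫ l')).inv) ≫ (α_ (s ≫ q) e l').inv =
        ((α_ s p l).hom ≫ s ◁ (θ ≫ (α_ q e l').inv) ≫ (α_ s (q ≫ e) l').inv) ≫
          (α_ s q e).inv ▷ l' := by
      simp
    rw [e1, h]
    simp

/-- Two spans sharing their apex and a leg are pasted by composing the operations. -/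
@[simps]
def paste {m n : K} {l : m ⟶ x} {c : m ⟶ y} {r : m ⟶ z} {l' : n ⟶ x} {c' : n ⟶ y} {r' : n ⟶ z}
    (φ : Fam l c l' c') (ψ : Fam c r c' r') : Fam l r l' r' where
  app p q θ := ψ.app p q (φ.app p q θ)
  nat_left σ θ := by rw [φ.nat_left, ψ.nat_left]
  nat_right θ τ := by rw [φ.nat_right, ψ.nat_right]
  nat_dom s p q θ := by rw [φ.nat_dom, ψ.nat_dom]

/-- Replacing legs by equal ones. -/
@[simps]
def ofEq {m n : K} {l r : m ⟶ x} {l' r' : n ⟶ x} (h : l = r) (h' : l' = r') :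
    Fam l r l' r' where
  app p q θ := eqToHom (by rw [h]) ≫ θ ≫ eqToHom (by rw [h'])
  nat_left σ θ := by subst h h'; simp
  nat_right θ τ := by subst h h'; simp
  nat_dom s p q θ := by subst h h'; simp

/-- Lifting through an ff 1-arrow and whiskering with another 1-arrow. -/
@[simps]
noncomputable def lift {m : K} {l : m ⟶ x} (hl : IsFF l) (r : m ⟶ y) : Fam l r l r where
  app p q θ := hl.lift θ ▷ r
  nat_left σ θ := by
    rw [← Bicategory.comp_whiskerRight]; congr 1; apply hl.hom_ext; simp
  nat_right θ τ := by
    rw [← Bicategory.comp_whiskerRight]; congr 1; apply hl.hom_ext; simp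
  nat_dom s p q θ := by
    have : hl.lift ((α_ s p l).hom ≫ s ◁ θ ≫ (α_ s q l).inv) = s ◁ hl.lift θ := by
      apply hl.hom_ext; simp
    rw [this]; simp

end Fam

namespace FractionMap

variable {S : TwoSite K} {x y z : K}

/-- A family of operations gives a map of fractions, by evaluation at the universal cone. -/
def ofFam {F G : Fraction S x y} (φ : Fam F.cover F.arrow G.cover G.arrow) : FractionMap F G where
  cell := φ.app (F.pr₁ G) (F.pr₂ G) (eqToHom (F.pr_comm G))

/-- The family of operations given by a map of fractions. -/
@[simps]
noncomputable def fam {F G : Fraction S x y} (t : FractionMap F G) :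
    Fam F.cover F.arrow G.cover G.arrow where
  app := t.app
  nat_left := t.app_nat_left
  nat_right := t.app_nat_right
  nat_dom := t.app_nat_dom

lemma app_eq_of_cell {F G : Fraction S x y} (t : FractionMap F G)
    (φ : Fam F.cover F.arrow G.cover G.arrow)
    (h : t.cell = φ.app (F.pr₁ G) (F.pr₂ G) (eqToHom (F.pr_comm G))) {a : K} (p : a ⟶ F.apex)
    (q : a ⟶ G.apex) (θ : p ≫ F.cover ⟶ q ≫ G.cover) : t.app p q θ = φ.app p q θ := by
  have strict : ∀ {b : K} (p : b ⟶ F.apex) (q : b ⟶ G.apex) (h : p ≫ F.cover = q ≫ G.cover),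
      φ.app p q (eqToHom h) = t.atCone p q h := by
    intro b p q h
    obtain ⟨l, rfl, rfl⟩ := exists_cone p q h
    rw [atCone_lift, ‹t.cell = _›, ← φ.nat_dom]
    congr 1
    simp [Strict.associator_eqToIso]
  obtain ⟨c, π, r, hπ, hw⟩ := exists_cover F (q ≫ G.cover)
  apply S.hom_ext_of_cover hπ
  have hs : r ≫ F.cover = (π ≫ q) ≫ G.cover := by rw [Strict.assoc, hw]
  have e := φ.nat_left ((S.ff F.cover F.mem).lift ((α_ π p F.cover).hom ≫ π ◁ θ ≫ eqToHom hw))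
    (eqToHom hs)
  have e' := φ.nat_dom π p q θ
  have e'' : (S.ff F.cover F.mem).lift ((α_ π p F.cover).hom ≫ π ◁ θ ≫ eqToHom hw) ▷ F.cover ≫
      eqToHom hs = (α_ π p F.cover).hom ≫ π ◁ θ ≫ (α_ π q G.cover).inv := by
    simp [Strict.associator_eqToIso]
  rw [e'', e', strict] at e
  rw [whiskerLeft_app t _ _ _ _ _ hw, ← reassoc_of% e]
  simp

@[simp]
lemma ofFam_app {F G : Fraction S x y} (φ : Fam F.cover F.arrow G.cover G.arrow) {a : K}
    (p : a ⟶ F.apex) (q : a ⟶ G.apex) (θ : p ≫ F.cover ⟶ q ≫ G.cover) :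
    (ofFam φ).app p q θ = φ.app p q θ :=
  app_eq_of_cell _ φ rfl p q θ

@[simp]
lemma id_app (F : Fraction S x y) {a : K} (p q : a ⟶ F.apex) (θ : p ≫ F.cover ⟶ q ≫ F.cover) :
    (FractionMap.id F).app p q θ = (S.ff F.cover F.mem).lift θ ▷ F.arrow :=
  app_eq_of_cell _ (Fam.lift (S.ff F.cover F.mem) F.arrow) rfl p q θ

lemma app_pr {F G : Fraction S x y} (t : FractionMap F G) :
    t.app (F.pr₁ G) (F.pr₂ G) (eqToHom (F.pr_comm G)) = t.cell := by
  rw [app_eqToHom, atCone_pr]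

lemma app_comp_whisker_left {F G : Fraction S x y} (t : FractionMap F G) {a : K}
    {p p' : a ⟶ F.apex} {q : a ⟶ G.apex} (α : p' ≫ F.cover ⟶ p ≫ F.cover)
    (θ : p ≫ F.cover ⟶ q ≫ G.cover) :
    t.app p' q (α ≫ θ) = (S.ff F.cover F.mem).lift α ▷ F.arrow ≫ t.app p q θ := by
  rw [← app_nat_left, IsFF.lift_whiskerRight]

lemma app_comp_whisker_right {F G : Fraction S x y} (t : FractionMap F G) {a : K}
    {p : a ⟶ F.apex} {q q' : a ⟶ G.apex} (θ : p ≫ F.cover ⟶ q ≫ G.cover)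
    (α : q ≫ G.cover ⟶ q' ≫ G.cover) :
    t.app p q' (θ ≫ α) = t.app p q θ ≫ (S.ff G.cover G.mem).lift α ▷ G.arrow := by
  rw [← app_nat_right, IsFF.lift_whiskerRight]

/-- Vertical composition on strict cones. -/
lemma comp_atCone {F G H : Fraction S x y} (s : FractionMap F G) (t : FractionMap G H) {a : K}
    (p : a ⟶ F.apex) (m : a ⟶ G.apex) (q : a ⟶ H.apex) (h₁ : p ≫ F.cover = m ≫ G.cover)
    (h₂ : m ≫ G.cover = q ≫ H.cover) :
    (s.comp t).atCone p q (h₁.trans h₂) = s.atCone p m h₁ ≫ t.atCone m q h₂ := by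
  obtain ⟨l, rfl, rfl⟩ := exists_cone p q (h₁.trans h₂)
  obtain ⟨n, rfl, rfl⟩ : ∃ n : a ⟶ S.pb (F.pr₁ H ≫ F.cover) G.cover G.mem,
      n ≫ S.fst (F.pr₁ H ≫ F.cover) G.cover G.mem = l ∧
      n ≫ S.snd (F.pr₁ H ≫ F.cover) G.cover G.mem = m := by
    have h : l ≫ F.pr₁ H ≫ F.cover = m ≫ G.cover := by rw [← Strict.assoc, h₁]
    exact ⟨(S.isPullback _ _ _).lift l m h, IsPullback.lift_fst _ _ _ _,
      IsPullback.lift_snd _ _ _ _⟩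
  rw [atCone_lift, comp_whiskerLeft]
  simp only [FractionMap.comp]
  rw [S.whiskerLeft_desc, atCone_congr s (Strict.assoc _ _ _) rfl, atCone_comp s,
    atCone_congr t rfl (Strict.assoc _ _ _), atCone_comp t]
  · simp [Strict.associator_eqToIso]
  · have := (S.isPullback (F.pr₁ H ≫ F.cover) G.cover G.mem).w
    rw [Strict.assoc, ← F.pr_comm H, this]
  · have := (S.isPullback (F.pr₁ H ≫ F.cover) G.cover G.mem).w
    rw [Strict.assoc, this]

/-- Vertical composition on arbitrary cones. -/
lemma comp_app {F G H : Fraction S x y} (s : FractionMap F G) (t : FractionMap G H) {a : K}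
    {p : a ⟶ F.apex} {m : a ⟶ G.apex} {q : a ⟶ H.apex} (θ : p ≫ F.cover ⟶ m ≫ G.cover)
    (θ' : m ≫ G.cover ⟶ q ≫ H.cover) :
    (s.comp t).app p q (θ ≫ θ') = s.app p m θ ≫ t.app m q θ' := by
  obtain ⟨b, π, m', hπ, hw⟩ := exists_cover G (q ≫ H.cover)
  obtain ⟨c, π', p', hπ', hw'⟩ := exists_cover F (m' ≫ G.cover)
  apply S.hom_ext_of_cover (S.comp_mem hπ' hπ)
  have hm : (π' ≫ m') ≫ G.cover = ((π' ≫ π) ≫ q) ≫ H.cover := by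
    simp only [Strict.assoc]; rw [hw]
  have hp : p' ≫ F.cover = (π' ≫ m') ≫ G.cover := by rw [Strict.assoc, hw']
  have key : ∀ {F G : Fraction S x y} (t : FractionMap F G) {a b : K} (s : b ⟶ a)
      {p : a ⟶ F.apex} {q : a ⟶ G.apex} (θ : p ≫ F.cover ⟶ q ≫ G.cover),
      s ◁ t.app p q θ = (α_ s p F.arrow).inv ≫ t.app (s ≫ p) (s ≫ q)
        ((α_ s p F.cover).hom ≫ s ◁ θ ≫ (α_ s q G.cover).inv) ≫ (α_ s q G.arrow).hom := by
    intro F G t a b s p q θ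
    rw [app_nat_dom]; simp
  have f1 : (α_ (π' ≫ π) p F.cover).hom ≫ (π' ≫ π) ◁ (θ ≫ θ') ≫ (α_ (π' ≫ π) q H.cover).inv =
    ((α_ (π' ≫ π) p F.cover).hom ≫ (π' ≫ π) ◁ (θ ≫ θ') ≫ (α_ (π' ≫ π) q H.cover).inv ≫
      eqToHom (hp.trans hm).symm) ≫ eqToHom (hp.trans hm) := by simp
  have f2 : (α_ (π' ≫ π) m G.cover).hom ≫ (π' ≫ π) ◁ θ' ≫ (α_ (π' ≫ π) q H.cover).inv =
    ((α_ (π' ≫ π) m G.cover).hom ≫ (π' ≫ π) ◁ θ' ≫ (α_ (π' ≫ π) q H.cover).inv ≫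
      eqToHom hm.symm) ≫ eqToHom hm := by simp
  have f3 : ((α_ (π' ≫ π) p F.cover).hom ≫ (π' ≫ π) ◁ θ ≫ (α_ (π' ≫ π) m G.cover).inv) ≫
      ((α_ (π' ≫ π) m G.cover).hom ≫ (π' ≫ π) ◁ θ' ≫ (α_ (π' ≫ π) q H.cover).inv ≫
      eqToHom hm.symm) = ((α_ (π' ≫ π) p F.cover).hom ≫ (π' ≫ π) ◁ (θ ≫ θ') ≫
        (α_ (π' ≫ π) q H.cover).inv ≫ eqToHom (hp.trans hm).symm) ≫ eqToHom hp := by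
    simp
  rw [whiskerLeft_comp, key, key, key, f1, app_comp_whisker_left, app_eqToHom,
    comp_atCone _ _ _ _ _ hp hm, ← app_eqToHom, ← app_eqToHom]
  rw [f2, app_comp_whisker_left t]
  have g := app_comp_whisker_right s
    ((α_ (π' ≫ π) p F.cover).hom ≫ (π' ≫ π) ◁ θ ≫ (α_ (π' ≫ π) m G.cover).inv)
    ((α_ (π' ≫ π) m G.cover).hom ≫ (π' ≫ π) ◁ θ' ≫ (α_ (π' ≫ π) q H.cover).inv ≫
      eqToHom hm.symm)
  rw [f3, app_comp_whisker_left] at g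
  simp only [Category.assoc, Iso.hom_inv_id_assoc] at g ⊢
  rw [reassoc_of% g]

/-- Maps of fractions agree if they agree on all cones, locally. -/
lemma ext_local {F G : Fraction S x y} {s t : FractionMap F G}
    (h : ∀ {a : K} (p : a ⟶ F.apex) (q : a ⟶ G.apex) (θ : p ≫ F.cover ⟶ q ≫ G.cover),
      ∃ (b : K) (π : b ⟶ a), S.J π ∧
        s.app (π ≫ p) (π ≫ q) ((α_ π p F.cover).hom ≫ π ◁ θ ≫ (α_ π q G.cover).inv) =
        t.app (π ≫ p) (π ≫ q) ((α_ π p F.cover).hom ≫ π ◁ θ ≫ (α_ π q G.cover).inv)) :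
    s = t := by
  ext1
  rw [← app_pr, ← app_pr]
  obtain ⟨b, π, hπ, e⟩ := h (F.pr₁ G) (F.pr₂ G) (eqToHom (F.pr_comm G))
  apply S.hom_ext_of_cover hπ
  rw [app_nat_dom, app_nat_dom] at e
  simpa using e

lemma ext_app {F G : Fraction S x y} {s t : FractionMap F G}
    (h : ∀ {a : K} (p : a ⟶ F.apex) (q : a ⟶ G.apex) (θ : p ≫ F.cover ⟶ q ≫ G.cover),
      s.app p q θ = t.app p q θ) : s = t := by
  ext1
  rw [← app_pr, ← app_pr, h]

/-- It suffices to compare maps of fractions on cones which factor through given fractions. -/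
lemma ext_via {F G : Fraction S x y} {s t : FractionMap F G} (H I J : Fraction S x y)
    (h : ∀ {a : K} (p : a ⟶ F.apex) (q : a ⟶ G.apex) (θ : p ≫ F.cover ⟶ q ≫ G.cover)
      (k : a ⟶ H.apex) (_ : k ≫ H.cover ≅ q ≫ G.cover)
      (m : a ⟶ I.apex) (_ : m ≫ I.cover ≅ q ≫ G.cover)
      (n : a ⟶ J.apex) (_ : n ≫ J.cover ≅ q ≫ G.cover),
      s.app p q θ = t.app p q θ) : s = t := by
  apply ext_local
  intro a p q θ
  obtain ⟨b, π, k, hπ, hk⟩ := exists_cover H (q ≫ G.cover)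
  obtain ⟨c, π', m, hπ', hm⟩ := exists_cover I (π ≫ q ≫ G.cover)
  obtain ⟨d, π'', n, hπ'', hn⟩ := exists_cover J (π' ≫ π ≫ q ≫ G.cover)
  refine ⟨d, π'' ≫ π' ≫ π, S.comp_mem hπ'' (S.comp_mem hπ' hπ), ?_⟩
  refine h _ _ _ (π'' ≫ π' ≫ k) (eqToIso ?_) (π'' ≫ m) (eqToIso ?_) n (eqToIso ?_)
  · simp only [Strict.assoc, hk]
  · simp only [Strict.assoc, hm]
  · simp only [Strict.assoc, hn]

lemma comp_app_of_iso {F G H : Fraction S x y} (s : FractionMap F G) (t : FractionMap G H) {a : K}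
    {p : a ⟶ F.apex} {m : a ⟶ G.apex} {q : a ⟶ H.apex} (θ : p ≫ F.cover ⟶ q ≫ H.cover)
    (β : m ≫ G.cover ≅ q ≫ H.cover) :
    (s.comp t).app p q θ = s.app p m (θ ≫ β.inv) ≫ t.app m q β.hom := by
  rw [← comp_app]; simp

lemma app_trans {F G H : Fraction S x y} (s : FractionMap F G) (t : FractionMap G H) {a : K}
    {p : a ⟶ F.apex} {m : a ⟶ G.apex} {q : a ⟶ H.apex} (θ : p ≫ F.cover ⟶ m ≫ G.cover)
    (θ' : m ≫ G.cover ⟶ q ≫ H.cover) :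
    s.app p m θ ≫ t.app m q θ' = (s.comp t).app p q (θ ≫ θ') :=
  (comp_app s t θ θ').symm

lemma app_trans_assoc {F G H : Fraction S x y} (s : FractionMap F G) (t : FractionMap G H) {a : K}
    {p : a ⟶ F.apex} {m : a ⟶ G.apex} {q : a ⟶ H.apex} (θ : p ≫ F.cover ⟶ m ≫ G.cover)
    (θ' : m ≫ G.cover ⟶ q ≫ H.cover) {r : a ⟶ y} (h : q ≫ H.arrow ⟶ r) :
    s.app p m θ ≫ t.app m q θ' ≫ h = (s.comp t).app p q (θ ≫ θ') ≫ h := by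
  rw [comp_app, Category.assoc]

lemma id_app_id (F : Fraction S x y) {a : K} (p : a ⟶ F.apex) :
    (FractionMap.id F).app p p (𝟙 _) = 𝟙 _ := by
  simp

@[simp]
lemma id_comp {F G : Fraction S x y} (t : FractionMap F G) : (FractionMap.id F).comp t = t :=
  ext_app fun p q θ ↦ by
    have := comp_app (FractionMap.id F) t (𝟙 _) θ
    rw [id_app_id] at this
    simpa using this

@[simp]
lemma comp_id {F G : Fraction S x y} (t : FractionMap F G) : t.comp (FractionMap.id G) = t :=
  ext_app fun p q θ ↦ by
    have := comp_app t (FractionMap.id G) θ (𝟙 _)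
    rw [id_app_id] at this
    simpa using this

lemma assoc {F G H I : Fraction S x y} (r : FractionMap F G) (s : FractionMap G H)
    (t : FractionMap H I) : (r.comp s).comp t = r.comp (s.comp t) :=
  ext_via G H H fun p q θ k β m γ _ _ ↦ by
    rw [comp_app_of_iso _ t θ γ, comp_app_of_iso r _ θ β, comp_app_of_iso s t _ γ,
      show θ ≫ γ.inv = (θ ≫ β.inv) ≫ (β.hom ≫ γ.inv) by simp, comp_app]
    simp

end FractionMap

/-- The category of fractions from `x` to `y` and maps of fractions. -/
noncomputable instance Fraction.category {S : TwoSite K} {x y : K} :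
    Category (Fraction S x y) where
  Hom F G := FractionMap F G
  id F := FractionMap.id F
  comp s t := s.comp t
  id_comp := FractionMap.id_comp
  comp_id := FractionMap.comp_id
  assoc := FractionMap.assoc

namespace Fraction

variable {S : TwoSite K} {x y z t : K}

/-- The projection from the apex of a composite fraction to the apex of its first factor. -/
abbrev left (F : Fraction S x y) (G : Fraction S y z) : (F.comp G).apex ⟶ F.apex :=
  S.fst F.arrow G.cover G.mem

/-- The projection from the apex of a composite fraction to the apex of its second factor. -/
abbrev right (F : Fraction S x y) (G : Fraction S y z) : (F.comp G).apex ⟶ G.apex :=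
  S.snd F.arrow G.cover G.mem

lemma left_right_comm (F : Fraction S x y) (G : Fraction S y z) :
    F.left G ≫ F.arrow = F.right G ≫ G.cover :=
  (S.isPullback F.arrow G.cover G.mem).w

end Fraction

namespace FractionMap

open Fraction

variable {S : TwoSite K} {x y z t : K}

/-- Horizontal composition of maps of fractions `s : F ⟶ F'` and `t : G ⟶ G'`, with
`F, F' : x → y` and `G, G' : y → z`: on the pullback over `x` of the apexes of `F.comp G` and
`F'.comp G'`, restrict `s` to obtain a 2-arrow between the two 1-arrows to `y`, and extend `t` along
it (see `hcomp_app`). If `t` is an identity, this is the lift of the restriction of `s` through the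
cover of `G`, whiskered with the right leg of `G`: this is right whiskering. If `s` is an identity,
it extends `t` along the image under the right leg of `F` of the canonical lift through the cover
of `F`, and the extension is defined by descent: this is left whiskering. -/
noncomputable def hcomp {F F' : Fraction S x y} {G G' : Fraction S y z}
    (s : FractionMap F F') (t : FractionMap G G') : FractionMap (F.comp G) (F'.comp G') :=
  ofFam ((((s.fam.pullLeft (F.left G)).pullRight (F'.left G')).paste
    (Fam.ofEq (F.left_right_comm G) (F'.left_right_comm G'))).paste
  ((t.fam.pullLeft (F.right G)).pullRight (F'.right G')))

lemma hcomp_app {F F' : Fraction S x y} {G G' : Fraction S y z}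
    (s : FractionMap F F') (t : FractionMap G G') {a : K} (p : a ⟶ (F.comp G).apex)
    (q : a ⟶ (F'.comp G').apex) (θ : p ≫ F.left G ≫ F.cover ⟶ q ≫ F'.left G' ≫ F'.cover) :
    FractionMap.app (hcomp s t) p q θ =
      (α_ p (F.right G) G.arrow).inv ≫ t.app (p ≫ F.right G) (q ≫ F'.right G')
        ((α_ p (F.right G) G.cover).hom ≫ eqToHom (by rw [left_right_comm]) ≫
          (α_ p (F.left G) F.arrow).inv ≫
          s.app (p ≫ F.left G) (q ≫ F'.left G')
            ((α_ p (F.left G) F.cover).hom ≫ θ ≫ (α_ q (F'.left G') F'.cover).inv) ≫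
          (α_ q (F'.left G') F'.arrow).hom ≫ eqToHom (by rw [left_right_comm]) ≫
          (α_ q (F'.right G') G'.cover).inv) ≫ (α_ q (F'.right G') G'.arrow).hom := by
  rw [hcomp, ofFam_app]
  simp

lemma hcomp_comp {F F' F'' : Fraction S x y} {G G' G'' : Fraction S y z}
    (s : FractionMap F F') (s' : FractionMap F' F'') (t : FractionMap G G')
    (t' : FractionMap G' G'') :
    hcomp (s.comp s') (t.comp t') = (hcomp s t).comp (hcomp s' t') :=
  ext_via (F'.comp G') (F'.comp G') (F'.comp G') fun p q θ m β _ _ _ _ ↦ by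
    rw [comp_app_of_iso _ _ θ β]
    simp only [hcomp_app]
    simp [app_trans, app_trans_assoc, -id_app]

@[simp]
lemma hcomp_id (F : Fraction S x y) (G : Fraction S y z) :
    hcomp (FractionMap.id F) (FractionMap.id G) = FractionMap.id (F.comp G) :=
  ext_app fun p q θ ↦ by
    obtain ⟨σ, rfl, -⟩ := S.ff _ (F.comp G).mem p q θ
    rw [hcomp_app]
    have h : ∀ (c : (F.comp G).apex ⟶ y) (hc : F.left G ≫ F.arrow = c),
        σ ▷ F.left G ▷ F.arrow = (α_ _ _ _).hom ≫ eqToHom (by rw [hc]) ≫ σ ▷ c ≫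
          eqToHom (by rw [hc]) ≫ (α_ _ _ _).inv := by
      rintro _ rfl; simp
    have e₁ : (S.ff F.cover F.mem).lift ((α_ p (F.left G) F.cover).hom ≫
        σ ▷ (F.left G ≫ F.cover) ≫ (α_ q (F.left G) F.cover).inv) = σ ▷ F.left G :=
      (S.ff F.cover F.mem).hom_ext ((IsFF.lift_whiskerRight _ _).trans (by simp))
    have e₂ : (S.ff (F.comp G).cover (F.comp G).mem).lift (σ ▷ (F.comp G).cover) = σ :=
      (S.ff _ (F.comp G).mem).hom_ext (IsFF.lift_whiskerRight _ _)
    rw [id_app (F.comp G), e₂, id_app F, e₁, h _ (F.left_right_comm G), id_app G]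
    have e₃ : (S.ff G.cover G.mem).lift ((α_ p (F.right G) G.cover).hom ≫
        σ ▷ (F.right G ≫ G.cover) ≫ (α_ q (F.right G) G.cover).inv) = σ ▷ F.right G :=
      (S.ff G.cover G.mem).hom_ext ((IsFF.lift_whiskerRight _ _).trans (by simp))
    simp only [Category.assoc, Iso.inv_hom_id_assoc, eqToHom_trans_assoc, eqToHom_refl,
      Category.id_comp]
    rw [e₃]
    simp

/-- The associator: the canonical 2-arrow between the two composites, obtained by lifting the
identity successively through the three covers. -/
noncomputable def assocHom (F : Fraction S x y) (G : Fraction S y z) (H : Fraction S z t) :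
    FractionMap ((F.comp G).comp H) (F.comp (G.comp H)) :=
  ofFam <|
    (((((FractionMap.id F).fam.pullLeft (F.left G)).pullLeft ((F.comp G).left H)).pullRight
      (F.left (G.comp H))).paste
    (Fam.ofEq (by rw [left_right_comm]) (F.left_right_comm (G.comp H)))).paste <|
    ((((((FractionMap.id G).fam.pullLeft (F.right G)).pullLeft ((F.comp G).left H)).pullRight
      (G.left H)).pullRight (F.right (G.comp H))).paste
    (Fam.ofEq ((F.comp G).left_right_comm H) (by rw [left_right_comm]))).paste <|
    ((((FractionMap.id H).fam.pullLeft ((F.comp G).right H)).pullRight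
      (G.right H)).pullRight (F.right (G.comp H)))

/-- The inverse of the associator. -/
noncomputable def assocInv (F : Fraction S x y) (G : Fraction S y z) (H : Fraction S z t) :
    FractionMap (F.comp (G.comp H)) ((F.comp G).comp H) :=
  ofFam <|
    (((((FractionMap.id F).fam.pullRight (F.left G)).pullRight ((F.comp G).left H)).pullLeft
      (F.left (G.comp H))).paste
    (Fam.ofEq (F.left_right_comm (G.comp H)) (by rw [left_right_comm]))).paste <|
    ((((((FractionMap.id G).fam.pullRight (F.right G)).pullRight ((F.comp G).left H)).pullLeft
      (G.left H)).pullLeft (F.right (G.comp H))).paste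
    (Fam.ofEq (by rw [left_right_comm]) ((F.comp G).left_right_comm H))).paste <|
    ((((FractionMap.id H).fam.pullRight ((F.comp G).right H)).pullLeft
      (G.right H)).pullLeft (F.right (G.comp H)))

/-- The left unitor. -/
noncomputable def leftUnitorHom (F : Fraction S x y) :
    FractionMap ((Fraction.ofArrow S (𝟙 x)).comp F) F :=
  ofFam <| (Fam.ofEq ((Fraction.ofArrow S (𝟙 x)).left_right_comm F) rfl).paste
    ((FractionMap.id F).fam.pullLeft ((Fraction.ofArrow S (𝟙 x)).right F))

/-- The inverse of the left unitor. -/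
noncomputable def leftUnitorInv (F : Fraction S x y) :
    FractionMap F ((Fraction.ofArrow S (𝟙 x)).comp F) :=
  ofFam <| (Fam.ofEq rfl ((Fraction.ofArrow S (𝟙 x)).left_right_comm F)).paste
    ((FractionMap.id F).fam.pullRight ((Fraction.ofArrow S (𝟙 x)).right F))

/-- The right unitor. -/
noncomputable def rightUnitorHom (F : Fraction S x y) :
    FractionMap (F.comp (Fraction.ofArrow S (𝟙 y))) F :=
  ofFam <| ((FractionMap.id F).fam.pullLeft (F.left (Fraction.ofArrow S (𝟙 y)))).paste
    (Fam.ofEq (F.left_right_comm (Fraction.ofArrow S (𝟙 y))) rfl)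

/-- The inverse of the right unitor. -/
noncomputable def rightUnitorInv (F : Fraction S x y) :
    FractionMap F (F.comp (Fraction.ofArrow S (𝟙 y))) :=
  ofFam <| ((FractionMap.id F).fam.pullRight (F.left (Fraction.ofArrow S (𝟙 y)))).paste
    (Fam.ofEq rfl (F.left_right_comm (Fraction.ofArrow S (𝟙 y))))


lemma id_one_app {a : K} (p q : a ⟶ (Fraction.ofArrow S (𝟙 x)).apex)
    (θ : p ≫ (Fraction.ofArrow S (𝟙 x)).cover ⟶ q ≫ (Fraction.ofArrow S (𝟙 x)).cover) :
    (FractionMap.id (Fraction.ofArrow S (𝟙 x))).app p q θ = θ := by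
  rw [id_app]
  exact IsFF.lift_whiskerRight _ _

lemma assocHom_comp_assocInv (F : Fraction S x y) (G : Fraction S y z) (H : Fraction S z t) :
    (assocHom F G H).comp (assocInv F G H) = FractionMap.id _ :=
  ext_via (F.comp (G.comp H)) (F.comp (G.comp H)) (F.comp (G.comp H)) fun p q θ m β _ _ _ _ ↦ by
    rw [comp_app_of_iso _ _ θ β, ← hcomp_id, ← hcomp_id]
    simp only [hcomp_app, assocHom, assocInv, ofFam_app, Fam.paste_app, Fam.pullLeft_app,
      Fam.pullRight_app, fam_app, Fam.ofEq_app]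
    simp [app_trans, app_trans_assoc, -id_app, Strict.associator_eqToIso]

lemma assocInv_comp_assocHom (F : Fraction S x y) (G : Fraction S y z) (H : Fraction S z t) :
    (assocInv F G H).comp (assocHom F G H) = FractionMap.id _ :=
  ext_via ((F.comp G).comp H) ((F.comp G).comp H) ((F.comp G).comp H) fun p q θ m β _ _ _ _ ↦ by
    rw [comp_app_of_iso _ _ θ β, ← hcomp_id, ← hcomp_id]
    simp only [hcomp_app, assocHom, assocInv, ofFam_app, Fam.paste_app, Fam.pullLeft_app,
      Fam.pullRight_app, fam_app, Fam.ofEq_app]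
    simp [app_trans, app_trans_assoc, -id_app, Strict.associator_eqToIso]

lemma assoc_naturality {F F' : Fraction S x y} {G G' : Fraction S y z} {H H' : Fraction S z t}
    (r : FractionMap F F') (s : FractionMap G G') (u : FractionMap H H') :
    (hcomp (hcomp r s) u).comp (assocHom F' G' H') =
      (assocHom F G H).comp (hcomp r (hcomp s u)) :=
  ext_via ((F'.comp G').comp H') (F.comp (G.comp H)) (F.comp (G.comp H))
      fun p q θ m β n γ _ _ ↦ by
    rw [comp_app_of_iso _ _ θ β, comp_app_of_iso _ _ θ γ]
    simp only [hcomp_app, assocHom, ofFam_app, Fam.paste_app, Fam.pullLeft_app,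
      Fam.pullRight_app, fam_app, Fam.ofEq_app]
    simp [app_trans, app_trans_assoc, -id_app, Strict.associator_eqToIso]

lemma leftUnitorHom_comp_leftUnitorInv (F : Fraction S x y) :
    (leftUnitorHom F).comp (leftUnitorInv F) = FractionMap.id _ :=
  ext_via F F F fun p q θ m β _ _ _ _ ↦ by
    rw [comp_app_of_iso _ _ θ β, ← hcomp_id]
    simp only [hcomp_app, leftUnitorHom, leftUnitorInv, ofFam_app, Fam.paste_app, Fam.pullLeft_app,
      Fam.pullRight_app, fam_app, Fam.ofEq_app]
    simp [app_trans, app_trans_assoc, -id_app, id_one_app, Strict.associator_eqToIso]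

lemma leftUnitorInv_comp_leftUnitorHom (F : Fraction S x y) :
    (leftUnitorInv F).comp (leftUnitorHom F) = FractionMap.id _ :=
  ext_via _ F F fun p q θ m β _ _ _ _ ↦ by
    rw [comp_app_of_iso _ _ θ β]
    simp only [leftUnitorHom, leftUnitorInv, ofFam_app, Fam.paste_app, Fam.pullLeft_app,
      Fam.pullRight_app, fam_app, Fam.ofEq_app]
    simp [app_trans, app_trans_assoc, -id_app, Strict.associator_eqToIso]

lemma leftUnitor_naturality {F F' : Fraction S x y} (s : FractionMap F F') :
    (hcomp (FractionMap.id (Fraction.ofArrow S (𝟙 x))) s).comp (leftUnitorHom F') =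
      (leftUnitorHom F).comp s :=
  ext_via ((Fraction.ofArrow S (𝟙 x)).comp F') F F fun p q θ m β n γ _ _ ↦ by
    rw [comp_app_of_iso _ _ θ β, comp_app_of_iso _ _ θ γ]
    simp only [hcomp_app, leftUnitorHom, ofFam_app, Fam.paste_app, Fam.pullLeft_app,
      Fam.pullRight_app, fam_app, Fam.ofEq_app]
    simp [app_trans, app_trans_assoc, -id_app, id_one_app, Strict.associator_eqToIso]

lemma rightUnitorHom_comp_rightUnitorInv (F : Fraction S x y) :
    (rightUnitorHom F).comp (rightUnitorInv F) = FractionMap.id _ :=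
  ext_via F F F fun p q θ m β _ _ _ _ ↦ by
    rw [comp_app_of_iso _ _ θ β, ← hcomp_id]
    simp only [hcomp_app, rightUnitorHom, rightUnitorInv, ofFam_app, Fam.paste_app,
      Fam.pullLeft_app, Fam.pullRight_app, fam_app, Fam.ofEq_app]
    simp [app_trans, app_trans_assoc, -id_app, id_one_app, Strict.associator_eqToIso]

lemma rightUnitorInv_comp_rightUnitorHom (F : Fraction S x y) :
    (rightUnitorInv F).comp (rightUnitorHom F) = FractionMap.id _ :=
  ext_via (F.comp (Fraction.ofArrow S (𝟙 y))) F F fun p q θ m β _ _ _ _ ↦ by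
    rw [comp_app_of_iso _ _ θ β]
    simp only [rightUnitorHom, rightUnitorInv, ofFam_app, Fam.paste_app, Fam.pullLeft_app,
      Fam.pullRight_app, fam_app, Fam.ofEq_app]
    simp [app_trans, app_trans_assoc, -id_app, Strict.associator_eqToIso]

lemma rightUnitor_naturality {F F' : Fraction S x y} (s : FractionMap F F') :
    (hcomp s (FractionMap.id (Fraction.ofArrow S (𝟙 y)))).comp (rightUnitorHom F') =
      (rightUnitorHom F).comp s :=
  ext_via (F'.comp (Fraction.ofArrow S (𝟙 y))) F F fun p q θ m β n γ _ _ ↦ by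
    rw [comp_app_of_iso _ _ θ β, comp_app_of_iso _ _ θ γ]
    simp only [hcomp_app, rightUnitorHom, ofFam_app, Fam.paste_app, Fam.pullLeft_app,
      Fam.pullRight_app, fam_app, Fam.ofEq_app]
    simp [app_trans, app_trans_assoc, -id_app, id_one_app, Strict.associator_eqToIso]

lemma pentagon {t' : K} (F : Fraction S x y) (G : Fraction S y z) (H : Fraction S z t)
    (I : Fraction S t t') :
    (hcomp (assocHom F G H) (FractionMap.id I)).comp
        ((assocHom F (G.comp H) I).comp (hcomp (FractionMap.id F) (assocHom G H I))) =
      (assocHom (F.comp G) H I).comp (assocHom F G (H.comp I)) :=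
  ext_via ((F.comp (G.comp H)).comp I) (F.comp ((G.comp H).comp I))
      ((F.comp G).comp (H.comp I)) fun p q θ m β n γ k δ ↦ by
    rw [comp_app_of_iso _ _ θ β, comp_app_of_iso _ _ _ γ, comp_app_of_iso _ _ θ δ]
    simp only [← hcomp_id, hcomp_app, assocHom, ofFam_app, Fam.paste_app, Fam.pullLeft_app,
      Fam.pullRight_app, fam_app, Fam.ofEq_app]
    simp [app_trans, app_trans_assoc, -id_app, Strict.associator_eqToIso]

lemma triangle (F : Fraction S x y) (G : Fraction S y z) :
    (assocHom F (Fraction.ofArrow S (𝟙 y)) G).comp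
        (hcomp (FractionMap.id F) (leftUnitorHom G)) =
      hcomp (rightUnitorHom F) (FractionMap.id G) :=
  ext_via (F.comp ((Fraction.ofArrow S (𝟙 y)).comp G)) (F.comp G) (F.comp G)
      fun p q θ m β _ _ _ _ ↦ by
    rw [comp_app_of_iso _ _ θ β]
    simp only [hcomp_app, assocHom, leftUnitorHom, rightUnitorHom, ofFam_app, Fam.paste_app,
      Fam.pullLeft_app, Fam.pullRight_app, fam_app, Fam.ofEq_app]
    simp [app_trans, app_trans_assoc, -id_app, id_one_app, Strict.associator_eqToIso]

end FractionMap

/-- The objects of the bicategory of fractions: those of `K`. -/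
structure FractionBicat (S : TwoSite K) where
  /-- the object of `K`, viewed in the bicategory of fractions -/
  of ::
  /-- the underlying object of `K` -/
  as : K

namespace FractionBicat

variable {S : TwoSite K}

/-- The bicategory of fractions `K_J`: its 1-arrows are the fractions, composed by pullback, its
2-arrows are the maps of fractions. -/
noncomputable instance bicategory : Bicategory.{w, max u v} (FractionBicat S) where
  Hom X Y := Fraction S X.as Y.as
  id X := Fraction.ofArrow S (𝟙 X.as)
  comp F G := Fraction.comp F G
  homCategory X Y := inferInstanceAs (Category (Fraction S X.as Y.as))
  whiskerLeft F _ _ t := FractionMap.hcomp (FractionMap.id F) t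
  whiskerRight t G := FractionMap.hcomp t (FractionMap.id G)
  associator F G H :=
    { hom := FractionMap.assocHom F G H
      inv := FractionMap.assocInv F G H
      hom_inv_id := FractionMap.assocHom_comp_assocInv F G H
      inv_hom_id := FractionMap.assocInv_comp_assocHom F G H }
  leftUnitor F :=
    { hom := FractionMap.leftUnitorHom F
      inv := FractionMap.leftUnitorInv F
      hom_inv_id := FractionMap.leftUnitorHom_comp_leftUnitorInv F
      inv_hom_id := FractionMap.leftUnitorInv_comp_leftUnitorHom F }
  rightUnitor F :=
    { hom := FractionMap.rightUnitorHom F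
      inv := FractionMap.rightUnitorInv F
      hom_inv_id := FractionMap.rightUnitorHom_comp_rightUnitorInv F
      inv_hom_id := FractionMap.rightUnitorInv_comp_rightUnitorHom F }
  whiskerLeft_id F G := FractionMap.hcomp_id F G
  whiskerLeft_comp F _ _ _ s t := by
    have := FractionMap.hcomp_comp (FractionMap.id F) (FractionMap.id F) s t
    rwa [FractionMap.comp_id] at this
  id_whiskerLeft {X Y F G} t := by
    change _ = (FractionMap.leftUnitorHom F).comp (t.comp (FractionMap.leftUnitorInv G))
    rw [← FractionMap.assoc, ← FractionMap.leftUnitor_naturality, FractionMap.assoc,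
      FractionMap.leftUnitorHom_comp_leftUnitorInv, FractionMap.comp_id]
  comp_whiskerLeft {X Y Z T} F G {H H'} t := by
    change _ = (FractionMap.assocHom F G H).comp ((FractionMap.hcomp (FractionMap.id F)
      (FractionMap.hcomp (FractionMap.id G) t)).comp (FractionMap.assocInv F G H'))
    rw [← FractionMap.assoc, ← FractionMap.assoc_naturality, FractionMap.assoc,
      FractionMap.assocHom_comp_assocInv, FractionMap.comp_id, FractionMap.hcomp_id]
  id_whiskerRight F G := FractionMap.hcomp_id F G
  comp_whiskerRight s t G := by
    have := FractionMap.hcomp_comp s t (FractionMap.id G) (FractionMap.id G)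
    rwa [FractionMap.comp_id] at this
  whiskerRight_id {X Y F G} t := by
    change _ = (FractionMap.rightUnitorHom F).comp (t.comp (FractionMap.rightUnitorInv G))
    rw [← FractionMap.assoc, ← FractionMap.rightUnitor_naturality, FractionMap.assoc,
      FractionMap.rightUnitorHom_comp_rightUnitorInv, FractionMap.comp_id]
  whiskerRight_comp {X Y Z T F F'} t G H := by
    change _ = (FractionMap.assocInv F G H).comp ((FractionMap.hcomp (FractionMap.hcomp t
      (FractionMap.id G)) (FractionMap.id H)).comp (FractionMap.assocHom F' G H))
    rw [FractionMap.assoc_naturality, ← FractionMap.assoc,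
      FractionMap.assocInv_comp_assocHom, FractionMap.id_comp, FractionMap.hcomp_id]
  whisker_assoc {X Y Z T} F {G G'} t H := by
    change _ = (FractionMap.assocHom F G H).comp ((FractionMap.hcomp (FractionMap.id F)
      (FractionMap.hcomp t (FractionMap.id H))).comp (FractionMap.assocInv F G' H))
    rw [← FractionMap.assoc, ← FractionMap.assoc_naturality, FractionMap.assoc,
      FractionMap.assocHom_comp_assocInv, FractionMap.comp_id]
  whisker_exchange {X Y Z F F' G G'} s t := by
    change (FractionMap.hcomp (FractionMap.id F) t).comp (FractionMap.hcomp s (FractionMap.id G')) =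
      (FractionMap.hcomp s (FractionMap.id G)).comp (FractionMap.hcomp (FractionMap.id F') t)
    rw [← FractionMap.hcomp_comp, ← FractionMap.hcomp_comp]
    simp
  pentagon F G H I := FractionMap.pentagon F G H I
  triangle F G := FractionMap.triangle F G

end FractionBicat

namespace TwoSite

variable (S : TwoSite K)

/-- The action on 1-arrows of the inclusion of `K` in the bicategory of fractions:
`f ↦ (𝟙, f)`. -/
def incl {x y : K} (f : x ⟶ y) : (FractionBicat.of x : FractionBicat S) ⟶ FractionBicat.of y :=
  Fraction.ofArrow S f

/-- `q : x ⟶ y` is *locally split*: some cover of `y` factors through `q` up to an invertible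
2-arrow. -/
def IsLocallySplit {x y : K} (q : x ⟶ y) : Prop :=
  ∃ (u : K) (j : u ⟶ y) (s : u ⟶ x), S.J j ∧ Nonempty (s ≫ q ≅ j)

/-- Weak equivalences: the ff and locally split 1-arrows. -/
def IsWeakEquivalence {x y : K} (q : x ⟶ y) : Prop :=
  IsFF q ∧ S.IsLocallySplit q

end TwoSite

/-- A 1-arrow of a bicategory is an equivalence if it underlies an equivalence
`Bicategory.Equivalence`. -/
def IsEquivalence {B : Type u} [Bicategory.{w, v} B] {a b : B} (f : a ⟶ b) : Prop :=
  ∃ e : Bicategory.Equivalence a b, e.hom = f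

end JFractions

namespace JFractions

open Fraction

variable {K : Type u} [Bicategory.{w, v} K] [Bicategory.Strict K] {S : TwoSite K}

/-! An isomorphism between an endofraction and the identity fraction is the same as an isomorphism
in `K` between its two legs (`FractionMap.isoId`, `FractionMap.legIso`): evaluation on the cone
formed by the identity and the cover recovers the isomorphism of legs, and interchange gives the
converse.

Let a candidate inverse of `S.incl f` be a fraction with cover `j : u ⟶ y` and right leg `s : u ⟶
x`, and let `fst`, `snd` be the projections of the pullback of `f` and `j`. By this criterion the
counit amounts to `s ≫ f ≅ j`, which is the local splitting, and the unit to `fst ≅ snd ≫ s`.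
Triangle identities can always be arranged, so these two isomorphisms decide whether `S.incl f` is
an equivalence (`isEquivalence_incl_iff`).

If `f` is a weak equivalence, the first isomorphism is given. The second is the lift through `f` of
`fst ≫ f = snd ≫ j ≅ snd ≫ s ≫ f`.

Conversely, the two isomorphisms make `f` ff. As a projection opposite to `j`, `fst` is a cover of
`x`, so after restriction to a cover all 1-arrows to `x` factor through it, and unique lifts descend
(`existsUnique_lift_of_cover`). For 1-arrows that factor through `fst`
(`existsUnique_lift_of_factor`), `fst` and `j` being ff, whiskering with `f` becomes whiskering with
`snd`, because `fst ≫ f = snd ≫ j`. Since `snd ≫ s ≅ fst` is ff, whiskering with `snd` followed by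
whiskering with `s` is bijective. The second operation is injective, because `s ≫ f ≅ j` is ff, so
the first is bijective. -/

namespace FractionMap

/-! ### Fractions isomorphic to the identity fraction -/

/-- Restriction of a 2-arrow along a 1-arrow, prolonged by a 2-arrow between the legs, as a family
of operations from a span with legs related by `e` to the identity span. -/
@[simps]
def famToId {x m : K} {l r : m ⟶ x} (e : r ⟶ l) : Fam l r (𝟙 x) (𝟙 x) where
  app p _ θ := p ◁ e ≫ θ
  nat_left σ θ := by rw [← whisker_exchange_assoc]
  nat_right θ τ := by simp
  nat_dom s p q θ := by simp

/-- The family of operations from the identity span to a span with legs related by `e`. -/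
@[simps]
def famOfId {x m : K} {l r : m ⟶ x} (e : l ⟶ r) : Fam (𝟙 x) (𝟙 x) l r where
  app _ q θ := θ ≫ q ◁ e
  nat_left σ θ := by simp
  nat_right θ τ := by rw [Category.assoc, Category.assoc, whisker_exchange]
  nat_dom s p q θ := by simp

/-- A fraction whose legs are isomorphic is isomorphic to the identity fraction. -/
noncomputable def isoId {x : K} {F : Fraction S x x} (e : F.cover ≅ F.arrow) :
    F ≅ Fraction.ofArrow S (𝟙 x) where
  hom := FractionMap.ofFam (famToId e.inv)
  inv := FractionMap.ofFam (famOfId e.hom)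
  -- Only the first fraction given to `ext_via` matters: it supplies the middle leg `m` through
  -- which the composite is evaluated. The other two are placeholders.
  hom_inv_id := ext_via (Fraction.ofArrow S (𝟙 x)) F F fun p q θ m β _ _ _ _ ↦ by
    change (FractionMap.comp _ _).app p q θ = (FractionMap.id F).app p q θ
    rw [comp_app_of_iso _ _ θ β, ofFam_app, ofFam_app, id_app]
    -- With `θ = σ ▷ F.cover`, what remains is that conjugation by `e` turns this into `σ ▷
    -- F.arrow`, which is interchange.
    obtain ⟨σ, rfl, -⟩ := S.ff _ F.mem p q θ
    have hσ : (S.ff F.cover F.mem).lift (σ ▷ F.cover) = σ :=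
      (S.ff _ F.mem).hom_ext (IsFF.lift_whiskerRight _ _)
    rw [hσ]
    simp only [famToId_app, famOfId_app, Category.assoc, Iso.inv_hom_id_assoc]
    rw [← whisker_exchange, whiskerLeft_inv_hom_assoc]
  inv_hom_id := ext_via F F F fun p q θ m β _ _ _ _ ↦ by
    change (FractionMap.comp _ _).app p q θ = (FractionMap.id (Fraction.ofArrow S (𝟙 x))).app p q θ
    rw [comp_app_of_iso _ _ θ β, ofFam_app, ofFam_app, id_one_app]
    simp

/-- An isomorphism of fractions induces isomorphisms on invertible cones. -/
noncomputable def appIso {x y : K} {F G : Fraction S x y} (t : F ≅ G) {a : K} {p : a ⟶ F.apex}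
    {q : a ⟶ G.apex} (θ : p ≫ F.cover ≅ q ≫ G.cover) : p ≫ F.arrow ≅ q ≫ G.arrow where
  hom := FractionMap.app t.hom p q θ.hom
  inv := FractionMap.app t.inv q p θ.inv
  hom_inv_id := by
    rw [← comp_app, Iso.hom_inv_id]
    -- Composition in the category of fractions is `FractionMap.comp` by definition, so the equation
    -- `t.hom_inv_id` can be evaluated on the cone `(p, p)`.
    exact (congrArg (fun s : FractionMap F F ↦ s.app p p (𝟙 _)) t.hom_inv_id).trans
      (id_app_id F p)
  inv_hom_id := by
    rw [← comp_app, Iso.inv_hom_id]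
    exact (congrArg (fun s : FractionMap G G ↦ s.app q q (𝟙 _)) t.inv_hom_id).trans
      (id_app_id G q)

/-- The legs of a fraction isomorphic to the identity fraction are isomorphic. -/
noncomputable def legIso {x : K} {F : Fraction S x x} (t : F ≅ Fraction.ofArrow S (𝟙 x)) :
    F.cover ≅ F.arrow :=
  -- The identity fraction has apex `x` and cover `𝟙 x`, so `F.cover` itself can serve as the second
  -- leg of a cone over `𝟙 F.apex`.
  ((ρ_ F.cover).symm ≪≫ (appIso t (p := 𝟙 F.apex) (q := F.cover)
    (λ_ F.cover ≪≫ (ρ_ F.cover).symm)).symm) ≪≫ λ_ F.arrow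

end FractionMap

namespace TwoSite

/-! ### Equivalences in terms of a cover and a local section -/

/-- `incl f` is an equivalence if and only if there are a cover `j : u ⟶ y` and `s : u ⟶ x` such
that `s ≫ f ≅ j` and such that the projections of the pullback of `f` and `j` satisfy
`fst ≅ snd ≫ s`. -/
lemma isEquivalence_incl_iff {x y : K} (f : x ⟶ y) :
    IsEquivalence (S.incl f) ↔ ∃ (u : K) (j : u ⟶ y) (hj : S.J j) (s : u ⟶ x),
      Nonempty (s ≫ f ≅ j) ∧ Nonempty (S.fst f j hj ≅ S.snd f j hj ≫ s) := by
  constructor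
  · rintro ⟨⟨_, G, η, c, -⟩, rfl⟩
    refine ⟨G.apex, G.cover, G.mem, G.arrow, ⟨?_⟩, ⟨?_⟩⟩
    -- The counit gives `fst ≫ G.cover ≅ snd ≫ f` on the pullback of `G.arrow` along `𝟙 x`. The
    -- section `r` of `fst` with `r ≫ snd = G.arrow` restricts it to the required isomorphism on
    -- `G.apex`.
    · replace c := FractionMap.legIso (F := G.comp (Fraction.ofArrow S f)) c
      have h := S.isPullback G.arrow (𝟙 x) (S.id_mem x)
      let r := h.lift (𝟙 G.apex) G.arrow ((Strict.id_comp _).trans (Strict.comp_id _).symm)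
      have h₁ : r ≫ S.fst G.arrow (𝟙 x) (S.id_mem x) = 𝟙 _ := h.lift_fst _ _ _
      have h₂ : r ≫ S.snd G.arrow (𝟙 x) (S.id_mem x) = G.arrow := h.lift_snd _ _ _
      exact eqToIso ((congrArg (· ≫ f) h₂).symm.trans (Strict.assoc _ _ _)) ≪≫
        (whiskerLeftIso r c).symm ≪≫
        eqToIso (by rw [← Strict.assoc, h₁, Strict.id_comp])
    -- Here the composite fraction has legs `fst ≫ 𝟙 x` and `snd ≫ G.arrow`.
    · exact (ρ_ _).symm ≪≫ FractionMap.legIso (F := (Fraction.ofArrow S f).comp G) η.symm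
  · rintro ⟨u, j, hj, s, ⟨i⟩, ⟨e⟩⟩
    let G : Fraction S y x := ⟨u, j, hj, s⟩
    let η : (Fraction.ofArrow S f).comp G ≅ Fraction.ofArrow S (𝟙 x) :=
      FractionMap.isoId (ρ_ _ ≪≫ e)
    -- On the pullback of `s` along `𝟙 x` one has `fst ≫ s = snd ≫ 𝟙 x`, whence `fst ≫ j ≅ fst ≫ s ≫
    -- f = snd ≫ f`.
    let c : G.comp (Fraction.ofArrow S f) ≅ Fraction.ofArrow S (𝟙 y) :=
      FractionMap.isoId (whiskerLeftIso _ i.symm ≪≫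
        eqToIso (by rw [← Strict.assoc, (S.isPullback s (𝟙 x) (S.id_mem x)).w, Strict.comp_id]))
    exact ⟨Equivalence.mkOfAdjointifyCounit (B := FractionBicat S)
      (a := .of x) (b := .of y) (f := S.incl f) (g := G) η.symm c, rfl⟩

/-! ### Full faithfulness, tested on a cover -/

/-- Whiskering with `s` is faithful if `s ≫ f` is isomorphic to an ff 1-arrow. -/
lemma whiskerRight_injective_of_iso {x y u z : K} {f : x ⟶ y} {j : u ⟶ y} (hj : IsFF j)
    {s : u ⟶ x} (i : s ≫ f ≅ j) {p q : z ⟶ u} {a b : p ⟶ q} (h : a ▷ s = b ▷ s) : a = b := by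
  apply hj.hom_ext
  have key (c : p ⟶ q) : c ▷ j = p ◁ i.inv ≫ (α_ _ _ _).inv ≫ c ▷ s ▷ f ≫ (α_ _ _ _).hom ≫
      q ◁ i.hom := by
    rw [← whiskerRight_comp_assoc, ← whisker_exchange, whiskerLeft_inv_hom_assoc]
  rw [key, key, h]

/-- The whiskerings of a 2-arrow with the two composites of a commutative square agree. -/
lemma whiskerRight_whiskerRight_of_eq {x y p u a : K} {l : p ⟶ x} {f : x ⟶ y} {r : p ⟶ u}
    {j : u ⟶ y} (comm : l ≫ f = r ≫ j) {q q' : a ⟶ p} (τ : q ⟶ q') :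
    τ ▷ l ▷ f = eqToHom (by rw [Strict.assoc, comm, Strict.assoc]) ≫ τ ▷ r ▷ j ≫
      eqToHom (by rw [Strict.assoc, Strict.assoc, comm]) := by
  -- Both sides of `comm` are composites, so it cannot be substituted; a variable `m` in place of `r
  -- ≫ j` can.
  have key (m : p ⟶ y) (hm : l ≫ f = m) : τ ▷ l ▷ f = (α_ _ _ _).hom ≫ eqToHom (by rw [hm]) ≫
      τ ▷ m ≫ eqToHom (by rw [hm]) ≫ (α_ _ _ _).inv := by
    subst hm; simp
  rw [key _ comm]
  simp [Strict.associator_eqToIso]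

/-- 2-arrows between 1-arrows which factor through the pullback of `f` and `j` lift uniquely
through `f`. -/
lemma existsUnique_lift_of_factor {x y u : K} {f : x ⟶ y} {j : u ⟶ y} (hj : S.J j) {s : u ⟶ x}
    (i : s ≫ f ≅ j) (e : S.fst f j hj ≅ S.snd f j hj ≫ s) {a : K} (q q' : a ⟶ S.pb f j hj)
    (c : (q ≫ S.fst f j hj) ≫ f ⟶ (q' ≫ S.fst f j hj) ≫ f) : ∃! b, b ▷ f = c := by
  have comm : S.fst f j hj ≫ f = S.snd f j hj ≫ j := (S.isPullback f j hj).w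
  have hfst := S.ff _ (S.fst_mem f j hj)
  -- Interchange with `e`: whiskering with `fst` is, up to conjugation, whiskering with `snd` and
  -- then with `s`.
  have nat (τ : q ⟶ q') : τ ▷ S.fst f j hj = q ◁ e.hom ≫ (α_ _ _ _).inv ≫
      τ ▷ S.snd f j hj ▷ s ≫ (α_ _ _ _).hom ≫ q' ◁ e.inv := by
    rw [← whiskerRight_comp_assoc, whisker_exchange_assoc, whiskerLeft_hom_inv, Category.comp_id]
  -- The square turns `c` into a 2-arrow between composites ending in `j`; `d` is its lift through
  -- `j`.
  obtain ⟨d, hd, -⟩ := S.ff j hj (q ≫ S.snd f j hj) (q' ≫ S.snd f j hj)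
    (eqToHom (by rw [Strict.assoc, Strict.assoc, comm]) ≫ c ≫
      eqToHom (by rw [Strict.assoc, comm, Strict.assoc]))
  obtain ⟨τ, hτ, -⟩ := hfst q q' (q ◁ e.hom ≫ (α_ _ _ _).inv ≫ d ▷ s ≫ (α_ _ _ _).hom ≫
    q' ◁ e.inv)
  -- By the choice of `τ`, the two sides agree after whiskering with `s`, which is faithful.
  have hτd : τ ▷ S.snd f j hj = d := by
    apply whiskerRight_injective_of_iso (S.ff j hj) i
    rw [nat, ← Category.assoc, ← Category.assoc (q ◁ e.hom)] at hτ
    exact (cancel_mono _).1 ((cancel_epi _).1 hτ)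
  refine ⟨τ ▷ S.fst f j hj, ?_, fun b hb ↦ ?_⟩
  · change _ ▷ f = c
    rw [whiskerRight_whiskerRight_of_eq comm, hτd, hd]
    simp
  · obtain ⟨σ, rfl, -⟩ := hfst q q' b
    congr 1
    -- By `nat`, a 2-arrow `q ⟶ q'` is determined by its whiskering with `snd`.
    suffices h : σ ▷ S.snd f j hj = d by
      apply hfst.hom_ext
      rw [nat, nat, h, hτd]
    apply (S.ff j hj).hom_ext
    rw [hd, ← hb, whiskerRight_whiskerRight_of_eq comm]
    simp

/-- Being ff may be checked on a cover of the source of the 1-arrows. -/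
lemma existsUnique_lift_of_cover {x y z t : K} {f : x ⟶ y} {π : t ⟶ z} (hπ : S.J π)
    {g h : z ⟶ x}
    (H : ∀ c : (π ≫ g) ≫ f ⟶ (π ≫ h) ≫ f, ∃! b, b ▷ f = c) (c : g ≫ f ⟶ h ≫ f) :
    ∃! b, b ▷ f = c := by
  obtain ⟨b, hb, hb'⟩ := H ((α_ _ _ _).hom ≫ π ◁ c ≫ (α_ _ _ _).inv)
  -- Covers are ff, so every 2-arrow `π ≫ g ⟶ π ≫ h` descends, without any compatibility condition
  -- to check.
  obtain ⟨β, rfl⟩ : ∃ β, π ◁ β = b := ⟨_, S.whiskerLeft_desc hπ b⟩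
  refine ⟨β, S.hom_ext_of_cover hπ ?_, fun β' h' ↦ S.hom_ext_of_cover hπ (hb' _ ?_)⟩
  · have hc : π ◁ c = (α_ _ _ _).inv ≫ (π ◁ β) ▷ f ≫ (α_ _ _ _).hom := by
      rw [show (π ◁ β) ▷ f = _ from hb]; simp
    rw [hc]
    simp
  · simp [← h']

/-- The projection `fst` of the pullback of `f` and `j` is a cover of `x`, hence any two 1-arrows to
`x` factor through it on a common cover of their source. -/
lemma isFF_of_isEquivalence_incl {x y : K} {f : x ⟶ y} (hf : IsEquivalence (S.incl f)) :
    IsFF f := by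
  obtain ⟨u, j, hj, s, ⟨i⟩, ⟨e⟩⟩ := (isEquivalence_incl_iff f).1 hf
  intro z g h c
  have hfst := S.fst_mem f j hj
  obtain ⟨t, π, q, hπ, hq⟩ : ∃ (t : K) (π : t ⟶ z) (q : t ⟶ S.pb f j hj), S.J π ∧
      π ≫ g = q ≫ S.fst f j hj := ⟨_, _, _, S.fst_mem g _ hfst, (S.isPullback g _ hfst).w⟩
  -- The second cover is taken over the first, so that on `t'` both `g` and `h` factor through
  -- `fst`.
  obtain ⟨t', π', q', hπ', hq'⟩ : ∃ (t' : K) (π' : t' ⟶ t) (q' : t' ⟶ S.pb f j hj), S.J π' ∧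
      π' ≫ π ≫ h = q' ≫ S.fst f j hj :=
    ⟨_, _, _, S.fst_mem (π ≫ h) _ hfst, (S.isPullback (π ≫ h) _ hfst).w⟩
  refine existsUnique_lift_of_cover (S.comp_mem hπ' hπ) ?_ c
  rw [show (π' ≫ π) ≫ g = (π' ≫ q) ≫ S.fst f j hj by rw [Strict.assoc, hq, Strict.assoc],
    show (π' ≫ π) ≫ h = q' ≫ S.fst f j hj by rw [Strict.assoc, hq']]
  exact existsUnique_lift_of_factor hj i e _ _

end TwoSite

/-! ### Equivalences and weak equivalences -/

/-- The lift of an invertible 2-arrow through an ff 1-arrow. -/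
noncomputable def IsFF.liftIso {x y : K} {f : x ⟶ y} (hf : IsFF f) {z : K} {g h : z ⟶ x}
    (a : g ≫ f ≅ h ≫ f) : g ≅ h where
  hom := hf.lift a.hom
  inv := hf.lift a.inv
  hom_inv_id := by rw [← hf.lift_comp, a.hom_inv_id, hf.lift_id]
  inv_hom_id := by rw [← hf.lift_comp, a.inv_hom_id, hf.lift_id]

end JFractions

theorem mainTheorem3 {K : Type u} [Bicategory.{w, v} K] [Bicategory.Strict K]
    (S : JFractions.TwoSite K) {x y : K} (f : x ⟶ y) :
    JFractions.IsEquivalence (S.incl f) ↔ S.IsWeakEquivalence f := by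
  refine ⟨fun hf ↦ ⟨JFractions.TwoSite.isFF_of_isEquivalence_incl hf, ?_⟩, ?_⟩
  · obtain ⟨u, j, hj, s, hi, -⟩ := (JFractions.TwoSite.isEquivalence_incl_iff f).1 hf
    exact ⟨u, j, s, hj, hi⟩
  · rintro ⟨hf, u, j, s, hj, ⟨i⟩⟩
    -- The local section already gives the inverse fraction; full faithfulness of `f` serves only to
    -- lift `fst ≫ f = snd ≫ j ≅ snd ≫ s ≫ f` to the unit condition.
    exact (JFractions.TwoSite.isEquivalence_incl_iff f).2 ⟨u, j, hj, s, ⟨i⟩,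
      ⟨hf.liftIso (eqToIso (S.isPullback f j hj).w ≪≫ whiskerLeftIso _ i.symm ≪≫
        (α_ _ _ _).symm)⟩⟩
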